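/- Let $T>0$. Let $A(t)\in\mathbb R^{n_x\times n_x}$, $B(t)$, $C_v(t)$, $C_e(t)$, $D_{vw}(t)$, $D_{ew}(t)$, $\bar v(t)\in\mathbb R^{n_v}$ ($t\in[0,T]$) be the data of a linear time-varying system with input $w(t)\in\mathbb R^{n_w}$, and let $M_1,\dots,M_m\in\mathbb R^{(n_v+n_w)\times(n_v+n_w)}$ be symmetric. Put $$A_a=\begin{bmatrix}A&0\\0&0\end{bmatrix},\quad B_a=\begin{bmatrix}B\\0\end{bmatrix},\quad C_{v,a}=\begin{bmatrix}C_v&\bar v\end{bmatrix},\quad C_{e,a}=\begin{bmatrix}C_e&0\end{bmatrix},$$ $$\begin{bmatrix}Q_0&S_0\\S_0^\top&R_0\end{bmatrix}=\begin{bmatrix}C_{e,a}^\top\\D_{ew}^\top\end{bmatrix}\begin{bmatrix}C_{e,a}&D_{ew}\end{bmatrix},\qquad \begin{bmatrix}Q_i&S_i\\S_i^\top&R_i\end{bmatrix}=\begin{bmatrix}C_{v,a}&D_{vw}\\0&I\end{bmatrix}^\top M_i\begin{bmatrix}C_{v,a}&D_{vw}\\0&I\end{bmatrix}\quad(1\le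 i\le m),$$ and for $\lambda\in\mathbb R^m$ let $(Q,S,R)(t,\lambda)=(Q_0,S_0,R_0)(t)+\sum_{i=1}^m\lambda_i(Q_i,S_i,R_i)(t)$. Assume that $A_a$, $B_a$ and, for every $\lambda\in\mathbb R^m$, $Q(\cdot,\lambda)$, $S(\cdot,\lambda)$, $R(\cdot,\lambda)$ are continuous on $[0,T]$. Write $e=\begin{bmatrix}0\\1\end{bmatrix}\in\mathbb R^{n_x+1}$. Let $J(\lambda)\in[-\infty,+\infty]$ be the infimum of $e^\top P(0)e$ over all differentiable functions $P$ from $[0,T]$ to the symmetric $(n_x+1)\times(n_x+1)$ matrices such that $P(T)\succeq0$ and $$\begin{bmatrix}\dot P+A_a^\top P+PA_a&PB_a\\B_a^\top P&0\end{bmatrix}+\begin{bmatrix}Q&S\\S^\top&R\end{bmatrix}\prec0\quad\text{for all }t\in[0,T],$$ with $J(\lambda)=+\infty$ if there is no such $P$, and let $\mathcal D=\{\lambda\in\mathbb R^m: J(\lambda)<\infty\}$. Consider, for $\lambda\in\mathbb R^m$, the linear-quadratic problem $$\max_{w\in\mathcal L_2[0,T]}\int_0^T\begin{bmatrix}x_a\\w\end{bmatrix}^\top\begin{bmatrix}Q(t,\lambda)&S(t,\lambda)\\S(t,\lambda)^\top&R(t,\lambda)\end{bmatrix}\begin{bmatrix}x_a\\w\end{bmatrix}dt\quad\text{subject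 to }\dot x_a=A_ax_a+B_aw,\ x_a(0)=e.$$ If $\lambda\in\mathcal D$, then: 1. The optimal value of this problem is equal to $J(\lambda)$. 2. There is a unique differentiable function $Y$ from $[0,T]$ to the symmetric matrices with $Y(T)=0$ and $\dot Y+A_a^\top Y+YA_a+Q-(YB_a+S)R^{-1}(YB_a+S)^\top=0$ on $[0,T]$ (with $Q,S,R$ at $(t,\lambda)$); there is a unique solution $x_a^*$ on $[0,T]$ of $\dot x_a^*=\bigl(A_a-B_aR^{-1}(YB_a+S)^\top\bigr)x_a^*$, $x_a^*(0)=e$; and, with $w^*=-R^{-1}(YB_a+S)^\top x_a^*$, the pair $(x_a^*,w^*)$ is admissible and attains the optimal value. 3. With $g\in\mathbb R^m$ defined by $$g_i=\int_0^T\begin{bmatrix}x_a^*\\w^*\end{bmatrix}^\top\begin{bmatrix}Q_i(t)&S_i(t)\\S_i(t)^\top&R_i(t)\end{bmatrix}\begin{bmatrix}x_a^*\\w^*\end{bmatrix}dt,$$ one has $J(\alpha)\ge J(\lambda)+g^\top(\alpha-\lambda)$ for all $\alpha\in\mathbb R^m$. -/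

import Mathlib

open scoped Matrix

noncomputable section

/-- Data of a linear time-varying system `ẋ = A x + B w`, `v = C_v x + D_vw w` (to which the
nominal signal `v̄` is added), `e = C_e x + D_ew w`, together with the matrices `M₁, …, M_m` of the
integral quadratic constraints. -/
structure UncertainLTV (nx nw nv ne m : ℕ) where
  A : ℝ → Matrix (Fin nx) (Fin nx) ℝ
  B : ℝ → Matrix (Fin nx) (Fin nw) ℝ
  Cv : ℝ → Matrix (Fin nv) (Fin nx) ℝ
  Ce : ℝ → Matrix (Fin ne) (Fin nx) ℝ
  Dvw : ℝ → Matrix (Fin nv) (Fin nw) ℝ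
  Dew : ℝ → Matrix (Fin ne) (Fin nw) ℝ
  vbar : ℝ → Fin nv → ℝ
  M : Fin m → Matrix (Fin nv ⊕ Fin nw) (Fin nv ⊕ Fin nw) ℝ

namespace UncertainLTV

variable {nx nw nv ne m : ℕ} (G : UncertainLTV nx nw nv ne m)

/-- `A_a = [A 0; 0 0]`. -/
def Aa (t : ℝ) : Matrix (Fin nx ⊕ Unit) (Fin nx ⊕ Unit) ℝ :=
  Matrix.fromBlocks (G.A t) 0 0 0

/-- `B_a = [B; 0]`. -/
def Ba (t : ℝ) : Matrix (Fin nx ⊕ Unit) (Fin nw) ℝ :=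
  Matrix.fromRows (G.B t) 0

/-- `C_{v,a} = [C_v v̄]`. -/
def Cva (t : ℝ) : Matrix (Fin nv) (Fin nx ⊕ Unit) ℝ :=
  Matrix.fromCols (G.Cv t) (Matrix.replicateCol Unit (G.vbar t))

/-- `C_{e,a} = [C_e 0]`. -/
def Cea (t : ℝ) : Matrix (Fin ne) (Fin nx ⊕ Unit) ℝ :=
  Matrix.fromCols (G.Ce t) 0

/-- `[Q₀ S₀; S₀ᵀ R₀] = [C_{e,a} D_ew]ᵀ [C_{e,a} D_ew]`. -/
def W0 (t : ℝ) : Matrix ((Fin nx ⊕ Unit) ⊕ Fin nw) ((Fin nx ⊕ Unit) ⊕ Fin nw) ℝ :=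
  (Matrix.fromCols (G.Cea t) (G.Dew t))ᵀ * Matrix.fromCols (G.Cea t) (G.Dew t)

/-- `[C_{v,a} D_vw; 0 I]`. -/
def outputMap (t : ℝ) : Matrix (Fin nv ⊕ Fin nw) ((Fin nx ⊕ Unit) ⊕ Fin nw) ℝ :=
  Matrix.fromBlocks (G.Cva t) (G.Dvw t) 0 1

/-- `[Q_i S_i; S_iᵀ R_i] = [C_{v,a} D_vw; 0 I]ᵀ M_i [C_{v,a} D_vw; 0 I]`. -/
def Wi (i : Fin m) (t : ℝ) : Matrix ((Fin nx ⊕ Unit) ⊕ Fin nw) ((Fin nx ⊕ Unit) ⊕ Fin nw) ℝ :=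
  (G.outputMap t)ᵀ * G.M i * G.outputMap t

/-- `[Q S; Sᵀ R] = [Q₀ S₀; S₀ᵀ R₀] + ∑ i, λ_i [Q_i S_i; S_iᵀ R_i]` at `(t, λ)`. -/
def W (t : ℝ) (l : Fin m → ℝ) :
    Matrix ((Fin nx ⊕ Unit) ⊕ Fin nw) ((Fin nx ⊕ Unit) ⊕ Fin nw) ℝ :=
  G.W0 t + ∑ i, l i • G.Wi i t

def Q (t : ℝ) (l : Fin m → ℝ) : Matrix (Fin nx ⊕ Unit) (Fin nx ⊕ Unit) ℝ :=
  (G.W t l).toBlocks₁₁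

def S (t : ℝ) (l : Fin m → ℝ) : Matrix (Fin nx ⊕ Unit) (Fin nw) ℝ :=
  (G.W t l).toBlocks₁₂

def R (t : ℝ) (l : Fin m → ℝ) : Matrix (Fin nw) (Fin nw) ℝ :=
  (G.W t l).toBlocks₂₂

/-- The augmented initial condition `[0; 1]`. -/
def xInit (nx : ℕ) : Fin nx ⊕ Unit → ℝ := Sum.elim 0 1

/-- `Pd` is the (entrywise) derivative of the matrix function `P` on `[0, T]`, one-sided at the
end points. -/
def IsMatrixDeriv (T : ℝ) (P Pd : ℝ → Matrix (Fin nx ⊕ Unit) (Fin nx ⊕ Unit) ℝ) : Prop :=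
  ∀ t ∈ Set.Icc 0 T, ∀ i j,
    HasDerivWithinAt (fun s => P s i j) (Pd t i j) (Set.Icc 0 T) t

/-- Left-hand side of the differential linear matrix inequality, for the values `P`, `Pd` of a
matrix function and its derivative at time `t`. -/
def dlmi (t : ℝ) (l : Fin m → ℝ) (P Pd : Matrix (Fin nx ⊕ Unit) (Fin nx ⊕ Unit) ℝ) :
    Matrix ((Fin nx ⊕ Unit) ⊕ Fin nw) ((Fin nx ⊕ Unit) ⊕ Fin nw) ℝ :=
  Matrix.fromBlocks (Pd + (G.Aa t)ᵀ * P + P * G.Aa t) (P * G.Ba t) ((G.Ba t)ᵀ * P) 0 + G.W t l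

/-- `P : [0, T] → 𝕊` is differentiable, `P(T) ⪰ 0`, and the DLMI is `≺ 0` on `[0, T]`. -/
def IsFeasible (T : ℝ) (l : Fin m → ℝ)
    (P : ℝ → Matrix (Fin nx ⊕ Unit) (Fin nx ⊕ Unit) ℝ) : Prop :=
  (∀ t ∈ Set.Icc 0 T, (P t).IsSymm) ∧ (P T).PosSemidef ∧
    ∃ Pd : ℝ → Matrix (Fin nx ⊕ Unit) (Fin nx ⊕ Unit) ℝ, IsMatrixDeriv T P Pd ∧
      ∀ t ∈ Set.Icc 0 T, (-G.dlmi t l (P t) (Pd t)).PosDef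

/-- `J(λ)`: the optimal (infimal) value of `[0;1]ᵀ P(0) [0;1]` over feasible `P`; it is `+∞` if no
`P` is feasible. -/
def J (T : ℝ) (l : Fin m → ℝ) : EReal :=
  ⨅ (P : ℝ → Matrix (Fin nx ⊕ Unit) (Fin nx ⊕ Unit) ℝ) (_ : G.IsFeasible T l P),
    ((xInit nx ⬝ᵥ P 0 *ᵥ xInit nx : ℝ) : EReal)

/-- The domain of `J`. -/
def domain (T : ℝ) : Set (Fin m → ℝ) := {l | G.J T l < ⊤}

/-- Left-hand side of the Riccati differential equation at time `t`. -/
def rde (t : ℝ) (l : Fin m → ℝ) (Y Yd : Matrix (Fin nx ⊕ Unit) (Fin nx ⊕ Unit) ℝ) :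
    Matrix (Fin nx ⊕ Unit) (Fin nx ⊕ Unit) ℝ :=
  Yd + (G.Aa t)ᵀ * Y + Y * G.Aa t + G.Q t l
    - (Y * G.Ba t + G.S t l) * (G.R t l)⁻¹ * (Y * G.Ba t + G.S t l)ᵀ

/-- `Y : [0, T] → 𝕊` is differentiable and solves the RDE on `[0, T]` with `Y(T) = 0`. -/
def IsRDESolution (T : ℝ) (l : Fin m → ℝ)
    (Y : ℝ → Matrix (Fin nx ⊕ Unit) (Fin nx ⊕ Unit) ℝ) : Prop :=
  (∀ t ∈ Set.Icc 0 T, (Y t).IsSymm) ∧ Y T = 0 ∧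
    ∃ Yd : ℝ → Matrix (Fin nx ⊕ Unit) (Fin nx ⊕ Unit) ℝ, IsMatrixDeriv T Y Yd ∧
      ∀ t ∈ Set.Icc 0 T, G.rde t l (Y t) (Yd t) = 0

/-- Admissible pairs of the linear-quadratic problem: `w ∈ L₂[0, T]` and `x` is the absolutely
continuous (Carathéodory) solution of `ẋ = A_a x + B_a w`, `x(0) = [0; 1]`. -/
def IsAdmissible (T : ℝ) (x : ℝ → Fin nx ⊕ Unit → ℝ) (w : ℝ → Fin nw → ℝ) : Prop :=
  MeasureTheory.MemLp w 2 (MeasureTheory.volume.restrict (Set.Icc 0 T)) ∧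
    ContinuousOn x (Set.Icc 0 T) ∧
    IntervalIntegrable (fun s => G.Aa s *ᵥ x s + G.Ba s *ᵥ w s) MeasureTheory.volume 0 T ∧
    ∀ t ∈ Set.Icc 0 T, x t = xInit nx + ∫ s in (0 : ℝ)..t, (G.Aa s *ᵥ x s + G.Ba s *ᵥ w s)

/-- The quadratic cost `∫₀ᵀ [x; w]ᵀ V(t) [x; w] dt` with weight `V`. -/
def quadCost (T : ℝ) (V : ℝ → Matrix ((Fin nx ⊕ Unit) ⊕ Fin nw) ((Fin nx ⊕ Unit) ⊕ Fin nw) ℝ)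
    (x : ℝ → Fin nx ⊕ Unit → ℝ) (w : ℝ → Fin nw → ℝ) : ℝ :=
  ∫ t in (0 : ℝ)..T, Sum.elim (x t) (w t) ⬝ᵥ V t *ᵥ Sum.elim (x t) (w t)

/-- The linear-quadratic cost with weight `[Q S; Sᵀ R](t, λ)`. -/
def lqCost (T : ℝ) (l : Fin m → ℝ) (x : ℝ → Fin nx ⊕ Unit → ℝ) (w : ℝ → Fin nw → ℝ) : ℝ :=
  quadCost T (fun t => G.W t l) x w

/-- The optimal value (supremum) of the linear-quadratic problem. -/
def lqValue (T : ℝ) (l : Fin m → ℝ) : EReal :=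
  ⨆ (x : ℝ → Fin nx ⊕ Unit → ℝ) (w : ℝ → Fin nw → ℝ) (_ : G.IsAdmissible T x w),
    ((G.lqCost T l x w : ℝ) : EReal)

/-- The feedback `w = -R⁻¹ (Y B_a + S)ᵀ x`. -/
def feedback (l : Fin m → ℝ) (Y : ℝ → Matrix (Fin nx ⊕ Unit) (Fin nx ⊕ Unit) ℝ)
    (x : ℝ → Fin nx ⊕ Unit → ℝ) (t : ℝ) : Fin nw → ℝ :=
  -(((G.R t l)⁻¹ * (Y t * G.Ba t + G.S t l)ᵀ) *ᵥ x t)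

/-- `x` solves `ẋ = (A_a - B_a R⁻¹ (Y B_a + S)ᵀ) x` on `[0, T]` with `x(0) = [0; 1]`. -/
def IsClosedLoop (T : ℝ) (l : Fin m → ℝ)
    (Y : ℝ → Matrix (Fin nx ⊕ Unit) (Fin nx ⊕ Unit) ℝ) (x : ℝ → Fin nx ⊕ Unit → ℝ) : Prop :=
  x 0 = xInit nx ∧ ∀ t ∈ Set.Icc 0 T,
    HasDerivWithinAt x
      ((G.Aa t - G.Ba t * (G.R t l)⁻¹ * (Y t * G.Ba t + G.S t l)ᵀ) *ᵥ x t) (Set.Icc 0 T) t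

/-- `g_i = ∫₀ᵀ [x; w]ᵀ [Q_i S_i; S_iᵀ R_i](t) [x; w] dt`. -/
def subgrad (T : ℝ) (x : ℝ → Fin nx ⊕ Unit → ℝ) (w : ℝ → Fin nw → ℝ) (i : Fin m) : ℝ :=
  quadCost T (fun t => G.Wi i t) x w

end UncertainLTV

end

/-! ### Global solutions of ODEs by radial truncation -/

noncomputable section

open Set Metric
open scoped NNReal

/-! Everything reduces to the Riccati solution `Y` with `Y(T) = 0`: both the infimum `J(λ)` and the
supremum of the linear-quadratic problem equal `eᵀY(0)e`.

A feasible `P` forces `R ≺ 0`, so the square in `w` can be completed (`quadForm_dlmi_eq_rde_add`)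
and the matrix inequality becomes a strict Riccati inequality for `P`, with quadratic coefficient `M
= -B_a R⁻¹ B_aᵀ ⪰ 0`. By that sign, solutions of the Riccati inequality lie above those of the
equation when their final values are so ordered (`riccati_comparison`). Comparison does three jobs:
together with an explicit scalar lower barrier it bounds `Y` a priori, so that `Y` exists on all of
`[0, T]` (`exists_riccati_solution`); it makes `Y` unique; and it gives `J(λ) ≥ eᵀY(0)e`. Adding a
small exponential multiple of the identity to `Y` makes the inequality strict, hence the reverse
bound (`exists_strict_riccati_near`).

On the primal side, integrating the derivative of `xᵀYx` along an admissible pair shows that the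
cost is `eᵀY(0)e + ∫ (w - w°)ᵀR(w - w°)`, where `w°` is the feedback evaluated along `x`
(`IsRegular.lqCost_eq`). As `R ≺ 0`, the closed loop is optimal.

The subgradient inequality is then a property of suprema: for a fixed pair the cost is affine in the
multiplier, with slope `g` at the optimal pair, and admissibility does not involve the multiplier.
-/

theorem exists_hasDerivWithinAt_of_lipschitz_bounded {E : Type*} [NormedAddCommGroup E]
    [NormedSpace ℝ E] [CompleteSpace E] {a b t₀ : ℝ} (ht₀ : t₀ ∈ Icc a b) {f : ℝ → E → E}
    {K L : ℝ} (hK : 0 ≤ K) (hL : 0 ≤ L)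
    (hlip : ∀ t ∈ Icc a b, ∀ x y, ‖f t x - f t y‖ ≤ K * ‖x - y‖)
    (hcont : ∀ x, ContinuousOn (fun t => f t x) (Icc a b))
    (hbd : ∀ t ∈ Icc a b, ∀ x, ‖f t x‖ ≤ L) (x₀ : E) :
    ∃ x : ℝ → E, x t₀ = x₀ ∧
      ∀ t ∈ Icc a b, HasDerivWithinAt x (f t (x t)) (Icc a b) t := by
  lift K to ℝ≥0 using hK
  lift L to ℝ≥0 using hL
  have hab : 0 ≤ b - a := sub_nonneg.2 (ht₀.1.trans ht₀.2)
  -- The field is bounded by `L` everywhere, so the ball may have radius `L * (b - a)`, the farthest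
  -- a solution can travel; no shrinking of the interval is needed.
  have hP : IsPicardLindelof f (⟨t₀, ht₀⟩ : Icc a b) x₀ (L * (b - a).toNNReal) 0 L K :=
    { lipschitzOnWith := fun t ht => LipschitzOnWith.of_dist_le_mul fun x _ y _ => by
        simpa only [dist_eq_norm] using hlip t ht x y
      continuousOn := fun x _ => hcont x
      norm_le := fun t ht x _ => hbd t ht x
      mul_max_le := by
        simp only [NNReal.coe_mul, Real.coe_toNNReal _ hab, NNReal.coe_zero, sub_zero]
        refine mul_le_mul_of_nonneg_left (max_le ?_ ?_) L.2
        · linarith [ht₀.1]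
        · linarith [ht₀.2] }
  exact hP.exists_eq_forall_mem_Icc_hasDerivWithinAt₀

section RadialClip

variable {E : Type*} [NormedAddCommGroup E] [NormedSpace ℝ E]

/-- The radial retraction onto the closed ball of radius `ρ`. -/
def radialClip (ρ : ℝ) (x : E) : E := (ρ / max ρ ‖x‖) • x

theorem radialClip_of_norm_le {ρ : ℝ} (hρ : 0 < ρ) {x : E} (hx : ‖x‖ ≤ ρ) :
    radialClip ρ x = x := by
  rw [radialClip, max_eq_left hx, div_self hρ.ne', one_smul]

theorem norm_radialClip_le {ρ : ℝ} (hρ : 0 < ρ) (x : E) : ‖radialClip ρ x‖ ≤ ρ := by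
  have h : 0 < max ρ ‖x‖ := lt_max_of_lt_left hρ
  rw [radialClip, norm_smul, Real.norm_of_nonneg (by positivity), div_mul_eq_mul_div,
    div_le_iff₀ h]
  exact mul_le_mul_of_nonneg_left (le_max_right _ _) hρ.le

theorem norm_radialClip_le_norm {ρ : ℝ} (hρ : 0 < ρ) (x : E) : ‖radialClip ρ x‖ ≤ ‖x‖ := by
  have h : 0 < max ρ ‖x‖ := lt_max_of_lt_left hρ
  rw [radialClip, norm_smul, Real.norm_of_nonneg (by positivity)]
  exact mul_le_of_le_one_left (norm_nonneg _) ((div_le_one h).2 (le_max_left _ _))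

/-- The difference splits into a rescaled `x - y` and a change of the scaling factor applied to `y`;
each contributes at most `‖x - y‖`. The constant 2 suits an arbitrary norm, and its value is
immaterial for Picard–Lindelöf. -/
theorem norm_radialClip_sub_le {ρ : ℝ} (hρ : 0 < ρ) (x y : E) :
    ‖radialClip ρ x - radialClip ρ y‖ ≤ 2 * ‖x - y‖ := by
  have ha : 0 < max ρ ‖x‖ := lt_max_of_lt_left hρ
  have hb : 0 < max ρ ‖y‖ := lt_max_of_lt_left hρ
  have hab : |max ρ ‖y‖ - max ρ ‖x‖| ≤ ‖x - y‖ := by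
    refine (abs_max_sub_max_le_max _ _ _ _).trans ?_
    rw [sub_self, abs_zero, max_eq_right (abs_nonneg _), norm_sub_rev x y]
    exact abs_norm_sub_norm_le y x
  have hsplit : radialClip ρ x - radialClip ρ y
      = (ρ / max ρ ‖x‖) • (x - y)
        + ((ρ / max ρ ‖x‖) * ((max ρ ‖y‖ - max ρ ‖x‖) / max ρ ‖y‖)) • y := by
    have : (ρ / max ρ ‖x‖) * ((max ρ ‖y‖ - max ρ ‖x‖) / max ρ ‖y‖)
        = ρ / max ρ ‖x‖ - ρ / max ρ ‖y‖ := by field_simp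
    rw [this, radialClip, radialClip, smul_sub, sub_smul]
    abel
  have h1 : ρ / max ρ ‖x‖ ≤ 1 := (div_le_one ha).2 (le_max_left _ _)
  have h2 : ‖y‖ / max ρ ‖y‖ ≤ 1 := (div_le_one hb).2 (le_max_right _ _)
  have h0 : 0 ≤ ρ / max ρ ‖x‖ := by positivity
  rw [hsplit]
  refine (norm_add_le _ _).trans ?_
  rw [norm_smul, norm_smul, norm_mul, Real.norm_of_nonneg h0, Real.norm_eq_abs, abs_div,
    abs_of_pos hb]
  have h3 : ρ / max ρ ‖x‖ * (|max ρ ‖y‖ - max ρ ‖x‖| / max ρ ‖y‖) * ‖y‖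
      = (ρ / max ρ ‖x‖) * (|max ρ ‖y‖ - max ρ ‖x‖| * (‖y‖ / max ρ ‖y‖)) := by ring
  rw [h3, two_mul]
  refine add_le_add (mul_le_of_le_one_left (norm_nonneg _) h1) ?_
  refine (mul_le_of_le_one_left (by positivity) h1).trans ?_
  exact (mul_le_of_le_one_right (abs_nonneg _) h2).trans hab

end RadialClip

theorem exists_norm_bound_Icc {E : Type*} [SeminormedAddCommGroup E] {a b : ℝ} {f : ℝ → E}
    (hf : ContinuousOn f (Icc a b)) : ∃ c : ℝ, 0 ≤ c ∧ ∀ t ∈ Icc a b, ‖f t‖ ≤ c := by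
  obtain ⟨c, hc⟩ := isCompact_Icc.exists_bound_of_continuousOn hf
  exact ⟨max c 0, le_max_right _ _, fun t ht => (hc t ht).trans (le_max_left _ _)⟩

section TruncatedRiccati

variable {𝔸 : Type*} [NormedRing 𝔸] [NormedAlgebra ℝ 𝔸] [CompleteSpace 𝔸]

/-- A Riccati equation in a Banach algebra, with the unknown on the right-hand side replaced by
the clipped value of its image under a bounded linear map, has a solution on all of `[a, b]`. -/
theorem exists_truncated_riccati {a b : ℝ} (hab : a ≤ b) {H₁ H₂ C M : ℝ → 𝔸}
    (h₁ : ContinuousOn H₁ (Icc a b)) (h₂ : ContinuousOn H₂ (Icc a b))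
    (hC : ContinuousOn C (Icc a b)) (hM : ContinuousOn M (Icc a b)) {ρ : ℝ} (hρ : 0 < ρ)
    (σ : 𝔸 →L[ℝ] 𝔸) :
    ∃ Z : ℝ → 𝔸, Z b = 0 ∧ ∀ t ∈ Icc a b,
      HasDerivWithinAt Z
        (-(H₁ t * radialClip ρ (σ (Z t)) + radialClip ρ (σ (Z t)) * H₂ t + C t
          + radialClip ρ (σ (Z t)) * M t * radialClip ρ (σ (Z t)))) (Icc a b) t := by
  obtain ⟨c₁, hc₁, hb₁⟩ := exists_norm_bound_Icc h₁
  obtain ⟨c₂, hc₂, hb₂⟩ := exists_norm_bound_Icc h₂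
  obtain ⟨c₃, hc₃, hb₃⟩ := exists_norm_bound_Icc hC
  obtain ⟨c₄, hc₄, hb₄⟩ := exists_norm_bound_Icc hM
  refine exists_hasDerivWithinAt_of_lipschitz_bounded (t₀ := b) (right_mem_Icc.2 hab)
    (f := fun t z => -(H₁ t * radialClip ρ (σ z) + radialClip ρ (σ z) * H₂ t + C t
          + radialClip ρ (σ z) * M t * radialClip ρ (σ z)))
    (K := (c₁ + c₂ + 2 * (ρ * c₄)) * (2 * ‖σ‖))
    (L := c₁ * ρ + ρ * c₂ + c₃ + ρ * c₄ * ρ) (by positivity) (by positivity) ?_ ?_ ?_ 0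
  · intro t ht z w
    set X := radialClip ρ (σ z)
    set Y := radialClip ρ (σ w)
    have hX : ‖X‖ ≤ ρ := norm_radialClip_le hρ _
    have hY : ‖Y‖ ≤ ρ := norm_radialClip_le hρ _
    have hXY : ‖X - Y‖ ≤ 2 * ‖σ‖ * ‖z - w‖ := by
      refine (norm_radialClip_sub_le hρ _ _).trans ?_
      rw [← map_sub, mul_assoc]
      exact mul_le_mul_of_nonneg_left (σ.le_opNorm _) zero_le_two
    have e : -(H₁ t * X + X * H₂ t + C t + X * M t * X)
        - -(H₁ t * Y + Y * H₂ t + C t + Y * M t * Y)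
        = -(H₁ t * (X - Y) + (X - Y) * H₂ t + ((X - Y) * M t * X + Y * M t * (X - Y))) := by
      noncomm_ring
    rw [e, norm_neg]
    have k₁ : ‖H₁ t * (X - Y)‖ ≤ c₁ * ‖X - Y‖ :=
      (norm_mul_le _ _).trans (mul_le_mul_of_nonneg_right (hb₁ t ht) (norm_nonneg _))
    have k₂ : ‖(X - Y) * H₂ t‖ ≤ ‖X - Y‖ * c₂ :=
      (norm_mul_le _ _).trans (mul_le_mul_of_nonneg_left (hb₂ t ht) (norm_nonneg _))
    have k₃ : ‖(X - Y) * M t * X‖ ≤ ‖X - Y‖ * c₄ * ρ :=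
      (norm_mul_le _ _).trans (mul_le_mul ((norm_mul_le _ _).trans
        (mul_le_mul_of_nonneg_left (hb₄ t ht) (norm_nonneg _))) hX (norm_nonneg _)
        (by positivity))
    have k₄ : ‖Y * M t * (X - Y)‖ ≤ ρ * c₄ * ‖X - Y‖ :=
      (norm_mul_le _ _).trans (mul_le_mul_of_nonneg_right ((norm_mul_le _ _).trans
        (mul_le_mul hY (hb₄ t ht) (norm_nonneg _) hρ.le)) (norm_nonneg _))
    calc _ ≤ c₁ * ‖X - Y‖ + ‖X - Y‖ * c₂ + (‖X - Y‖ * c₄ * ρ + ρ * c₄ * ‖X - Y‖) :=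
          norm_add_le_of_le (norm_add_le_of_le k₁ k₂) (norm_add_le_of_le k₃ k₄)
      _ = (c₁ + c₂ + 2 * (ρ * c₄)) * ‖X - Y‖ := by ring
      _ ≤ (c₁ + c₂ + 2 * (ρ * c₄)) * (2 * ‖σ‖ * ‖z - w‖) :=
          mul_le_mul_of_nonneg_left hXY (by positivity)
      _ = _ := by ring
  · intro z
    fun_prop
  · intro t ht z
    rw [norm_neg]
    have hX : ‖radialClip ρ (σ z)‖ ≤ ρ := norm_radialClip_le hρ _
    refine norm_add_le_of_le (norm_add_le_of_le (norm_add_le_of_le ?_ ?_) (hb₃ t ht)) ?_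
    · exact (norm_mul_le _ _).trans (mul_le_mul (hb₁ t ht) hX (norm_nonneg _) hc₁)
    · exact (norm_mul_le _ _).trans (mul_le_mul hX (hb₂ t ht) (norm_nonneg _) hρ.le)
    · exact (norm_mul_le _ _).trans (mul_le_mul ((norm_mul_le _ _).trans
        (mul_le_mul hX (hb₄ t ht) (norm_nonneg _) hρ.le)) hX (norm_nonneg _) (by positivity))

end TruncatedRiccati

section LinearODE

open scoped Matrix.Norms.Operator

variable {n : Type*} [Fintype n]

theorem exists_mulVec_bound {m : Type*} [Fintype m] {a b : ℝ} {A : ℝ → Matrix m n ℝ}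
    (hA : ContinuousOn A (Icc a b)) :
    ∃ c : ℝ, 0 ≤ c ∧ ∀ t ∈ Icc a b, ∀ v, ‖A t *ᵥ v‖ ≤ c * ‖v‖ := by
  obtain ⟨c, hc, hb⟩ := exists_norm_bound_Icc hA
  exact ⟨c, hc, fun t ht v => (Matrix.linfty_opNorm_mulVec _ _).trans
    (mul_le_mul_of_nonneg_right (hb t ht) (norm_nonneg _))⟩

theorem HasDerivWithinAt.Ici_of_Icc {E : Type*} [NormedAddCommGroup E] [NormedSpace ℝ E]
    {f : ℝ → E} {f' : E} {a b t : ℝ} (h : HasDerivWithinAt f f' (Icc a b) t) (ht : t ∈ Ico a b) :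
    HasDerivWithinAt f f' (Ici t) t :=
  h.mono_of_mem_nhdsWithin (Icc_mem_nhdsGE_of_mem ht)

/-- The linear field is clipped at a radius above the Grönwall bound. Clipping never increases the
norm, so the clipped solution obeys the same bound and the clip is never active. -/
theorem exists_linear_solution {a b : ℝ} (hab : a ≤ b) {A : ℝ → Matrix n n ℝ}
    (hA : ContinuousOn A (Icc a b)) (ξ : n → ℝ) :
    ∃ x : ℝ → n → ℝ, x a = ξ ∧
      ∀ t ∈ Icc a b, HasDerivWithinAt x (A t *ᵥ x t) (Icc a b) t := by
  obtain ⟨c, hc, hb⟩ := exists_mulVec_bound hA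
  set ρ := ‖ξ‖ * Real.exp (c * (b - a)) + 1
  have hρ : 0 < ρ := by positivity
  obtain ⟨x, hx0, hx⟩ := exists_hasDerivWithinAt_of_lipschitz_bounded (left_mem_Icc.2 hab)
    (f := fun t z => A t *ᵥ radialClip ρ z) (K := c * 2) (L := c * ρ)
    (by positivity) (by positivity)
    (fun t ht z w => by
      rw [← Matrix.mulVec_sub, mul_assoc]
      exact (hb t ht _).trans (mul_le_mul_of_nonneg_left (norm_radialClip_sub_le hρ _ _) hc))
    (fun z => by fun_prop)
    (fun t ht z => (hb t ht _).trans
      (mul_le_mul_of_nonneg_left (norm_radialClip_le hρ _) hc)) ξ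
  refine ⟨x, hx0, fun t ht => ?_⟩
  have hbound := norm_le_gronwallBound_of_norm_deriv_right_le (f := x) (δ := ‖ξ‖) (K := c)
    (ε := 0) (fun s hs => (hx s hs).continuousWithinAt)
    (fun s hs => (hx s (Ico_subset_Icc_self hs)).Ici_of_Icc hs) (by rw [hx0])
    (fun s hs => by
      rw [add_zero]
      exact (hb s (Ico_subset_Icc_self hs) _).trans
        (mul_le_mul_of_nonneg_left (norm_radialClip_le_norm hρ _) hc)) t ht
  rw [gronwallBound_ε0] at hbound
  have hle : ‖x t‖ ≤ ρ := by
    refine hbound.trans (le_add_of_le_of_nonneg ?_ zero_le_one)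
    gcongr
    exact ht.2
  simpa only [radialClip_of_norm_le hρ hle] using hx t ht

theorem linear_solution_unique {a b : ℝ} {A : ℝ → Matrix n n ℝ}
    (hA : ContinuousOn A (Icc a b)) {x y : ℝ → n → ℝ}
    (hx : ∀ t ∈ Icc a b, HasDerivWithinAt x (A t *ᵥ x t) (Icc a b) t)
    (hy : ∀ t ∈ Icc a b, HasDerivWithinAt y (A t *ᵥ y t) (Icc a b) t) (h : x a = y a) :
    EqOn x y (Icc a b) := by
  obtain ⟨c, hc, hb⟩ := exists_mulVec_bound hA
  intro t ht
  have hd : ∀ s ∈ Icc a b, HasDerivWithinAt (x - y) (A s *ᵥ (x - y) s) (Icc a b) s :=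
    fun s hs => by
      simpa only [Pi.sub_apply, Matrix.mulVec_sub] using (hx s hs).sub (hy s hs)
  exact sub_eq_zero.1 <| eq_zero_of_abs_deriv_le_mul_abs_self_of_eq_zero_right
    (f := x - y) (K := c) (fun s hs => (hd s hs).continuousWithinAt)
    (fun s hs => (hd s (Ico_subset_Icc_self hs)).Ici_of_Icc hs) (by simp [h])
    (fun s hs => hb s (Ico_subset_Icc_self hs) _) t ht

end LinearODE
end

/-! ### Entrywise matrix calculus, quadratic-form bounds and Riccati comparison -/

noncomputable section

open Set
open scoped NNReal

section MatrixCalculus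

variable {m n : Type*}

/-- `Pd` is the entrywise derivative of the matrix function `P` on the set `s`, within `s`. -/
def HasEntryDerivOn (s : Set ℝ) (P Pd : ℝ → Matrix m n ℝ) : Prop :=
  ∀ t ∈ s, ∀ i j, HasDerivWithinAt (fun r => P r i j) (Pd t i j) s t

theorem HasEntryDerivOn.mono {s r : Set ℝ} {P Pd : ℝ → Matrix m n ℝ}
    (h : HasEntryDerivOn s P Pd) (hr : r ⊆ s) : HasEntryDerivOn r P Pd :=
  fun t ht i j => (h t (hr ht) i j).mono hr

theorem HasEntryDerivOn.continuousOn {s : Set ℝ} {P Pd : ℝ → Matrix m n ℝ}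
    (h : HasEntryDerivOn s P Pd) : ContinuousOn P s :=
  continuousOn_pi.2 fun i => continuousOn_pi.2 fun j => fun t ht =>
    (h t ht i j).continuousWithinAt

theorem HasEntryDerivOn.add {s : Set ℝ} {P Pd Q Qd : ℝ → Matrix m n ℝ}
    (hP : HasEntryDerivOn s P Pd) (hQ : HasEntryDerivOn s Q Qd) :
    HasEntryDerivOn s (P + Q) (Pd + Qd) :=
  fun t ht i j => (hP t ht i j).add (hQ t ht i j)

theorem HasEntryDerivOn.sub {s : Set ℝ} {P Pd Q Qd : ℝ → Matrix m n ℝ}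
    (hP : HasEntryDerivOn s P Pd) (hQ : HasEntryDerivOn s Q Qd) :
    HasEntryDerivOn s (P - Q) (Pd - Qd) :=
  fun t ht i j => (hP t ht i j).sub (hQ t ht i j)

/-- Derivatives within a nondegenerate interval are unique, also at the end points. On a single
point every matrix would be a derivative, hence `a < b`. -/
theorem HasEntryDerivOn.isSymm_deriv {a b : ℝ} (hab : a < b) {P Pd : ℝ → Matrix n n ℝ}
    (hP : HasEntryDerivOn (Icc a b) P Pd) (hPs : ∀ t ∈ Icc a b, (P t).IsSymm) :
    ∀ t ∈ Icc a b, (Pd t).IsSymm := fun t ht => by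
  refine Matrix.IsSymm.ext fun i j => ?_
  refine (uniqueDiffOn_Icc hab t ht).eq_deriv _ (hP t ht j i) ?_
  exact (hP t ht i j).congr (fun s hs => (hPs s hs).apply i j) ((hPs t ht).apply i j)

theorem hasEntryDerivOn_smul_one [DecidableEq n] {s : Set ℝ} {c c' : ℝ → ℝ}
    (h : ∀ t ∈ s, HasDerivWithinAt c (c' t) s t) :
    HasEntryDerivOn s (fun t => c t • (1 : Matrix n n ℝ)) (fun t => c' t • 1) := by
  intro t ht i j
  simpa using (h t ht).mul_const ((1 : Matrix n n ℝ) i j)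

variable [Fintype n]

theorem HasDerivWithinAt.dotProduct {s : Set ℝ} {t : ℝ} {x y : ℝ → n → ℝ} {x' y' : n → ℝ}
    (hx : HasDerivWithinAt x x' s t) (hy : HasDerivWithinAt y y' s t) :
    HasDerivWithinAt (fun r => x r ⬝ᵥ y r) (x' ⬝ᵥ y t + x t ⬝ᵥ y') s t := by
  have := HasDerivWithinAt.fun_sum (u := Finset.univ)
    fun i _ => ((hasDerivWithinAt_pi.1 hx) i).fun_mul ((hasDerivWithinAt_pi.1 hy) i)
  simpa only [_root_.dotProduct, Finset.sum_add_distrib] using this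

theorem HasEntryDerivOn.mulVec {s : Set ℝ} {t : ℝ} (ht : t ∈ s) {D Dd : ℝ → Matrix m n ℝ}
    {x : ℝ → n → ℝ} {x' : n → ℝ} (hD : HasEntryDerivOn s D Dd)
    (hx : HasDerivWithinAt x x' s t) :
    HasDerivWithinAt (fun r => D r *ᵥ x r) (Dd t *ᵥ x t + D t *ᵥ x') s t := by
  refine hasDerivWithinAt_pi.2 fun i => ?_
  exact (hasDerivWithinAt_pi.2 (hD t ht i)).dotProduct hx

theorem HasEntryDerivOn.quadForm {s : Set ℝ} {t : ℝ} (ht : t ∈ s) {D Dd : ℝ → Matrix n n ℝ}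
    {x : ℝ → n → ℝ} {x' : n → ℝ} (hD : HasEntryDerivOn s D Dd)
    (hx : HasDerivWithinAt x x' s t) :
    HasDerivWithinAt (fun r => x r ⬝ᵥ D r *ᵥ x r)
      (x' ⬝ᵥ D t *ᵥ x t + x t ⬝ᵥ (Dd t *ᵥ x t + D t *ᵥ x')) s t :=
  hx.dotProduct (hD.mulVec ht hx)

end MatrixCalculus

section Bounds

variable {n : Type*} [Fintype n]

theorem dotProduct_self_nonneg_real (v : n → ℝ) : 0 ≤ v ⬝ᵥ v :=
  Finset.sum_nonneg fun i _ => mul_self_nonneg (v i)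

theorem abs_quadForm_le_of_entry_bound {X : Matrix n n ℝ} {c : ℝ} (h : ∀ i j, |X i j| ≤ c)
    (v : n → ℝ) : |v ⬝ᵥ X *ᵥ v| ≤ (Fintype.card n * c) * (v ⬝ᵥ v) := by
  have hterm : ∀ i j, |v i * (X i j * v j)| ≤ c * ((v i * v i + v j * v j) / 2) := by
    intro i j
    have h2 : |v i| * |v j| ≤ (v i * v i + v j * v j) / 2 := by
      nlinarith [sq_nonneg (|v i| - |v j|), abs_mul_abs_self (v i), abs_mul_abs_self (v j)]
    rw [abs_mul, abs_mul]
    calc |v i| * (|X i j| * |v j|) = |X i j| * (|v i| * |v j|) := by ring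
      _ ≤ c * ((v i * v i + v j * v j) / 2) :=
        mul_le_mul (h i j) h2 (by positivity) ((abs_nonneg _).trans (h i j))
  calc |v ⬝ᵥ X *ᵥ v| = |∑ i, ∑ j, v i * (X i j * v j)| := by
        simp only [dotProduct, Matrix.mulVec, Finset.mul_sum]
    _ ≤ ∑ i, ∑ j, c * ((v i * v i + v j * v j) / 2) :=
        (Finset.abs_sum_le_sum_abs _ _).trans <| Finset.sum_le_sum fun i _ =>
          (Finset.abs_sum_le_sum_abs _ _).trans <| Finset.sum_le_sum fun j _ => hterm i j
    _ = (Fintype.card n * c) * (v ⬝ᵥ v) := by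
        simp only [← Finset.mul_sum, ← Finset.sum_div, Finset.sum_add_distrib, Finset.sum_const,
          Finset.card_univ, nsmul_eq_mul, dotProduct]
        have e : ∑ x, v x * (Fintype.card n * v x) = Fintype.card n * ∑ x, v x * v x := by
          rw [Finset.mul_sum]
          exact Finset.sum_congr rfl fun x _ => by ring
        rw [e]
        ring

theorem exists_quadForm_bound {a b : ℝ} {X : ℝ → Matrix n n ℝ} (hX : ContinuousOn X (Icc a b)) :
    ∃ c : ℝ, 0 ≤ c ∧ ∀ t ∈ Icc a b, ∀ v, |v ⬝ᵥ X t *ᵥ v| ≤ c * (v ⬝ᵥ v) := by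
  have hX' : ContinuousOn (fun t => (fun i j => X t i j : n → n → ℝ)) (Icc a b) := hX
  obtain ⟨c, hc, hb⟩ := exists_norm_bound_Icc hX'
  refine ⟨Fintype.card n * c, by positivity, fun t ht v =>
    abs_quadForm_le_of_entry_bound (fun i j => ?_) v⟩
  exact ((norm_le_pi_norm (X t i) j).trans (norm_le_pi_norm (fun i j => X t i j) i)).trans
    (hb t ht)

theorem Matrix.IsSymm.dotProduct_mulVec_comm {X : Matrix n n ℝ} (hX : X.IsSymm) (v w : n → ℝ) :
    v ⬝ᵥ X *ᵥ w = w ⬝ᵥ X *ᵥ v := by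
  rw [Matrix.dotProduct_mulVec, ← Matrix.mulVec_transpose, hX.eq, dotProduct_comm]

/-- Polarisation with the vectors `e_i`, `e_j` and `e_i + e_j`. The last has squared length at most
4, attained for `i = j`, so `2|X i j| ≤ 4c + c + c`. -/
theorem abs_entry_le_of_quadForm_bound [DecidableEq n] {X : Matrix n n ℝ} (hX : X.IsSymm) {c : ℝ}
    (h : ∀ v, |v ⬝ᵥ X *ᵥ v| ≤ c * (v ⬝ᵥ v)) (i j : n) : |X i j| ≤ 3 * c := by
  have hdiag : ∀ k, |X k k| ≤ c := fun k => by simpa using h (Pi.single k 1)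
  have hsum := h (Pi.single i 1 + Pi.single j 1)
  have hc : 0 ≤ c := (abs_nonneg _).trans (hdiag i)
  have e : (Pi.single i 1 + Pi.single j 1 : n → ℝ) ⬝ᵥ X *ᵥ (Pi.single i 1 + Pi.single j 1)
      = X i i + 2 * X i j + X j j := by
    have := hX.apply i j
    simp [Matrix.mulVec_add, add_dotProduct, dotProduct_add, this]
    ring
  have e2 : (Pi.single i 1 + Pi.single j 1 : n → ℝ) ⬝ᵥ (Pi.single i 1 + Pi.single j 1) ≤ 4 := by
    rcases eq_or_ne i j with rfl | hij
    · simp [dotProduct_add]; norm_num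
    · simp [dotProduct_add, hij, hij.symm]; norm_num
  rw [e] at hsum
  have h4 := hsum.trans (mul_le_mul_of_nonneg_left e2 hc)
  have hi := abs_le.1 (hdiag i)
  have hj := abs_le.1 (hdiag j)
  rw [abs_le] at h4 ⊢
  constructor <;> linarith [h4.1, h4.2, hi.1, hi.2, hj.1, hj.2]

open scoped Matrix.Norms.Operator in
theorem norm_le_of_entry_bound {X : Matrix n n ℝ} {c : ℝ} (hc : 0 ≤ c)
    (h : ∀ i j, |X i j| ≤ c) : ‖X‖ ≤ Fintype.card n * c := by
  have hc' : 0 ≤ Fintype.card n * c := by positivity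
  rw [Matrix.linfty_opNorm_def, ← NNReal.coe_mk _ hc', NNReal.coe_le_coe]
  refine Finset.sup_le fun i _ => ?_
  rw [← NNReal.coe_le_coe, NNReal.coe_sum, NNReal.coe_mk]
  calc ∑ j, ‖X i j‖ ≤ ∑ _j : n, c := Finset.sum_le_sum fun j _ => h i j
    _ = Fintype.card n * c := by simp

end Bounds

section Comparison

variable {n : Type*} [Fintype n]

/-- If `D' + FᵀD + DF ⪯ 0` on `[a, b]` and `D(b) ⪰ 0`, then `D(a) ⪰ 0`. -/
theorem quadForm_nonneg_of_lyapunov {a b : ℝ} (hab : a ≤ b) {D Dd F : ℝ → Matrix n n ℝ}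
    (hD : HasEntryDerivOn (Icc a b) D Dd) (hF : ContinuousOn F (Icc a b))
    (hle : ∀ t ∈ Icc a b, ∀ v, v ⬝ᵥ (Dd t + (F t)ᵀ * D t + D t * F t) *ᵥ v ≤ 0)
    (hb : ∀ v, 0 ≤ v ⬝ᵥ D b *ᵥ v) (v : n → ℝ) : 0 ≤ v ⬝ᵥ D a *ᵥ v := by
  -- Transporting `v` along `x' = Fx` turns the Lyapunov expression into the derivative of `xᵀDx`,
  -- which is therefore nonincreasing.
  obtain ⟨x, hx0, hx⟩ := exists_linear_solution hab hF v
  have hq : ∀ t ∈ Icc a b, HasDerivWithinAt (fun r => x r ⬝ᵥ D r *ᵥ x r)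
      (x t ⬝ᵥ (Dd t + (F t)ᵀ * D t + D t * F t) *ᵥ x t) (Icc a b) t := by
    intro t ht
    convert! hD.quadForm ht (hx t ht) using 1
    simp only [Matrix.add_mulVec, dotProduct_add, ← Matrix.mulVec_mulVec]
    rw [Matrix.dotProduct_mulVec (x t) (F t)ᵀ, Matrix.vecMul_transpose]
    ring
  have hanti : AntitoneOn (fun r => x r ⬝ᵥ D r *ᵥ x r) (Icc a b) := by
    refine antitoneOn_of_hasDerivWithinAt_nonpos (convex_Icc a b)
      (fun t ht => (hq t ht).continuousWithinAt)
      (fun t ht => (hq t (interior_subset ht)).mono interior_subset)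
      (fun t ht => hle t (interior_subset ht) _)
  have := hanti (left_mem_Icc.2 hab) (right_mem_Icc.2 hab) hab
  simp only [hx0] at this
  exact (hb _).trans this

/-- The Riccati expression `P' + HᵀP + PH + C + PMP`. -/
def riccati (H C M P Pd : Matrix n n ℝ) : Matrix n n ℝ :=
  Pd + Hᵀ * P + P * H + C + P * M * P

/-- Expansion around `Y`: the part linear in `P - Y` is a Lyapunov expression with drift `H + MY`,
and only one quadratic remainder is left. -/
theorem riccati_sub_riccati {H C M P Pd Y Yd : Matrix n n ℝ} (hM : M.IsSymm) (hY : Y.IsSymm) :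
    (Pd - Yd) + (H + M * Y)ᵀ * (P - Y) + (P - Y) * (H + M * Y)
      = riccati H C M P Pd - riccati H C M Y Yd - (P - Y) * M * (P - Y) := by
  rw [Matrix.transpose_add, Matrix.transpose_mul, hM.eq, hY.eq, riccati, riccati]
  noncomm_ring

/-- Since `M ⪰ 0`, the remainder in `riccati_sub_riccati` has the favourable sign, so `P - Y`
satisfies a Lyapunov inequality. -/
theorem riccati_comparison {a b : ℝ} (hab : a ≤ b) {H C M P Pd Y Yd : ℝ → Matrix n n ℝ}
    (hH : ContinuousOn H (Icc a b)) (hMc : ContinuousOn M (Icc a b))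
    (hM : ∀ t ∈ Icc a b, (M t).PosSemidef)
    (hP : HasEntryDerivOn (Icc a b) P Pd) (hPs : ∀ t ∈ Icc a b, (P t).IsSymm)
    (hY : HasEntryDerivOn (Icc a b) Y Yd) (hYs : ∀ t ∈ Icc a b, (Y t).IsSymm)
    (hle : ∀ t ∈ Icc a b, ∀ v, v ⬝ᵥ riccati (H t) (C t) (M t) (P t) (Pd t) *ᵥ v
      ≤ v ⬝ᵥ riccati (H t) (C t) (M t) (Y t) (Yd t) *ᵥ v)
    (hb : ∀ v, v ⬝ᵥ Y b *ᵥ v ≤ v ⬝ᵥ P b *ᵥ v) (v : n → ℝ) :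
    v ⬝ᵥ Y a *ᵥ v ≤ v ⬝ᵥ P a *ᵥ v := by
  have hsub : ∀ (X Z : Matrix n n ℝ) (v : n → ℝ),
      v ⬝ᵥ (X - Z) *ᵥ v = v ⬝ᵥ X *ᵥ v - v ⬝ᵥ Z *ᵥ v := fun X Z v => by
    rw [Matrix.sub_mulVec, dotProduct_sub]
  have key := quadForm_nonneg_of_lyapunov hab (D := P - Y) (Dd := Pd - Yd)
    (F := fun t => H t + M t * Y t) (hP.sub hY) (hH.add (hMc.mul hY.continuousOn))
    (fun t ht v => by
      have hMs : (M t).IsSymm := by simpa using (hM t ht).isHermitian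
      simp only [Pi.sub_apply]
      rw [riccati_sub_riccati (C := C t) hMs (hYs t ht), hsub, hsub]
      have hD : (P t - Y t).IsSymm := (hPs t ht).sub (hYs t ht)
      have h1 : 0 ≤ v ⬝ᵥ ((P t - Y t) * M t * (P t - Y t)) *ᵥ v := by
        have := (hM t ht).dotProduct_mulVec_nonneg ((P t - Y t) *ᵥ v)
        rw [star_trivial] at this
        rw [← Matrix.mulVec_mulVec, ← Matrix.mulVec_mulVec, Matrix.dotProduct_mulVec,
          ← Matrix.mulVec_transpose, hD.eq]
        exact this
      linarith [hle t ht v])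
    (fun v => by rw [Pi.sub_apply, hsub]; linarith [hb v]) v
  rw [Pi.sub_apply, hsub] at key
  linarith

end Comparison
end

/-! ### Global existence for the Riccati equation -/

noncomputable section

open Set

section RiccatiExistence

variable {n : Type*} [Fintype n] [DecidableEq n]

theorem quadForm_riccati_smul_one (H C M : Matrix n n ℝ) (c c' : ℝ) (v : n → ℝ) :
    v ⬝ᵥ riccati H C M (c • 1) (c' • 1) *ᵥ v
      = c' * (v ⬝ᵥ v) + 2 * c * (v ⬝ᵥ H *ᵥ v) + v ⬝ᵥ C *ᵥ v + c ^ 2 * (v ⬝ᵥ M *ᵥ v) := by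
  have hT : v ⬝ᵥ Hᵀ *ᵥ v = v ⬝ᵥ H *ᵥ v := by
    rw [Matrix.dotProduct_mulVec, Matrix.vecMul_transpose, dotProduct_comm]
  simp [riccati, Matrix.add_mulVec, Matrix.smul_mulVec, hT]
  ring

/-- A solution of the Riccati equation with `Y(b) = 0` is bounded a priori, as soon as the Riccati
inequality has a solution `P` with `P(b) ⪰ 0`. -/
theorem exists_riccati_apriori_bound {a b : ℝ} {H C M P Pd : ℝ → Matrix n n ℝ}
    (hH : ContinuousOn H (Icc a b)) (hC : ContinuousOn C (Icc a b))
    (hMc : ContinuousOn M (Icc a b)) (hM : ∀ t ∈ Icc a b, (M t).PosSemidef)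
    (hP : HasEntryDerivOn (Icc a b) P Pd) (hPs : ∀ t ∈ Icc a b, (P t).IsSymm)
    (hle : ∀ t ∈ Icc a b, ∀ v, v ⬝ᵥ riccati (H t) (C t) (M t) (P t) (Pd t) *ᵥ v ≤ 0)
    (hPb : ∀ v, 0 ≤ v ⬝ᵥ P b *ᵥ v) :
    ∃ κ : ℝ, 0 ≤ κ ∧ ∀ s ∈ Icc a b, ∀ Y Yd : ℝ → Matrix n n ℝ,
      HasEntryDerivOn (Icc s b) Y Yd → (∀ t ∈ Icc s b, (Y t).IsSymm) → Y b = 0 →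
      (∀ t ∈ Icc s b, riccati (H t) (C t) (M t) (Y t) (Yd t) = 0) →
      ∀ v, |v ⬝ᵥ Y s *ᵥ v| ≤ κ * (v ⬝ᵥ v) := by
  obtain ⟨h, hh, hHb⟩ := exists_quadForm_bound hH
  obtain ⟨q, hq, hCb⟩ := exists_quadForm_bound hC
  obtain ⟨p, hp, hPbd⟩ := exists_quadForm_bound hP.continuousOn
  set k := 2 * h + 1 with hk
  refine ⟨max p (q * Real.exp (k * (b - a))), le_max_of_le_left hp,
    fun s hs Y Yd hY hYs hYb hYr v => ?_⟩
  have hsub : Icc s b ⊆ Icc a b := Icc_subset_Icc_left hs.1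
  have hvv := dotProduct_self_nonneg_real v
  rw [abs_le]
  constructor
  -- Lower barrier `-c(t)I` with `c(t) = q exp(k(b - t))`. Its Riccati form is at least `(kc - 2hc -
  -- q)|w|²`, which is nonnegative because `k = 2h + 1` and `c ≥ q`; the `M`-term only helps.
  · have hN : HasEntryDerivOn (Icc s b)
        (fun t => (-(q * Real.exp (k * (b - t)))) • (1 : Matrix n n ℝ))
        (fun t => (k * (q * Real.exp (k * (b - t)))) • 1) := by
      refine hasEntryDerivOn_smul_one fun t _ => ?_
      have h1 : HasDerivAt (fun t => k * (b - t)) (-k) t := by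
        simpa using ((hasDerivAt_id t).const_sub b).const_mul k
      convert! ((h1.exp.const_mul q).neg).hasDerivWithinAt using 1
      ring
    have hcmp := riccati_comparison hs.2 (H := H) (C := C) (M := M) (P := Y) (Pd := Yd)
      (hH.mono hsub) (hMc.mono hsub) (fun t ht => hM t (hsub ht)) hY hYs hN
      (fun t _ => by
        rw [Matrix.IsSymm, Matrix.transpose_smul, Matrix.transpose_one])
      (fun t ht w => by
        rw [hYr t ht, quadForm_riccati_smul_one, Matrix.zero_mulVec, dotProduct_zero]
        have hw := dotProduct_self_nonneg_real w
        have h1 := (abs_le.1 (hHb t (hsub ht) w)).2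
        have h2 := (abs_le.1 (hCb t (hsub ht) w)).1
        have h3 : 0 ≤ w ⬝ᵥ M t *ᵥ w := by
          simpa using (hM t (hsub ht)).dotProduct_mulVec_nonneg w
        have hexp : 1 ≤ Real.exp (k * (b - t)) :=
          Real.one_le_exp (mul_nonneg (by positivity) (sub_nonneg.2 ht.2))
        set c := q * Real.exp (k * (b - t))
        have hc : q ≤ c := le_mul_of_one_le_right hq hexp
        have h4 : c * (w ⬝ᵥ H t *ᵥ w) ≤ c * (h * (w ⬝ᵥ w)) :=
          mul_le_mul_of_nonneg_left h1 (hq.trans hc)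
        have h5 : q * (w ⬝ᵥ w) ≤ c * (w ⬝ᵥ w) := mul_le_mul_of_nonneg_right hc hw
        have h6 : 0 ≤ (-c) ^ 2 * (w ⬝ᵥ M t *ᵥ w) := mul_nonneg (sq_nonneg _) h3
        have h7 : k * c * (w ⬝ᵥ w) = 2 * (c * (h * (w ⬝ᵥ w))) + c * (w ⬝ᵥ w) := by
          rw [hk]; ring
        linarith)
      (fun w => by
        have hw := dotProduct_self_nonneg_real w
        simp only [hYb, Matrix.smul_mulVec, Matrix.one_mulVec, Matrix.zero_mulVec,
          dotProduct_zero, dotProduct_smul, smul_eq_mul]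
        have : 0 ≤ q * Real.exp (k * (b - b)) * (w ⬝ᵥ w) := by positivity
        linarith) v
    simp only [Matrix.smul_mulVec, Matrix.one_mulVec, dotProduct_smul, smul_eq_mul] at hcmp
    refine le_trans ?_ hcmp
    rw [neg_mul, neg_le_neg_iff]
    refine mul_le_mul_of_nonneg_right (le_max_of_le_right ?_) hvv
    have : k * (b - s) ≤ k * (b - a) := by
      refine mul_le_mul_of_nonneg_left ?_ (by positivity)
      linarith [hs.1]
    gcongr
  -- The given `P` is the upper barrier, so its own bound `p` on `[a, b]` serves for every `s`.
  · have hcmp := riccati_comparison hs.2 (H := H) (C := C) (M := M) (P := P) (Pd := Pd)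
      (hH.mono hsub) (hMc.mono hsub) (fun t ht => hM t (hsub ht)) (hP.mono hsub)
      (fun t ht => hPs t (hsub ht)) hY hYs
      (fun t ht w => by
        rw [hYr t ht, Matrix.zero_mulVec, dotProduct_zero]
        exact hle t (hsub ht) w)
      (fun w => by
        rw [hYb, Matrix.zero_mulVec, dotProduct_zero]
        exact hPb w) v
    exact hcmp.trans ((le_abs_self _).trans ((hPbd s hs v).trans
      (mul_le_mul_of_nonneg_right (le_max_left _ _) hvv)))

/-- Backward continuation of an a priori bound: if `g(s) ≤ κ` whenever `g ≤ ρ` on `[s, b]`, where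
`κ < ρ`, then `g ≤ ρ` on `[a, b]`. -/
theorem le_of_backward_apriori_bound {a b κ ρ : ℝ} {g : ℝ → ℝ} (hg : ContinuousOn g (Icc a b))
    (hb : g b ≤ κ) (hκ : κ < ρ)
    (h : ∀ s ∈ Icc a b, (∀ t ∈ Icc s b, g t ≤ ρ) → g s ≤ κ) : ∀ t ∈ Icc a b, g t ≤ ρ := by
  by_contra! hcon
  obtain ⟨t₁, ht₁, hgt⟩ := hcon
  set S := Icc a b ∩ g ⁻¹' Ici ρ
  have hS : IsClosed S := hg.preimage_isClosed_of_isClosed isClosed_Icc isClosed_Ici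
  have hSc : IsCompact S := isCompact_Icc.of_isClosed_subset hS inter_subset_left
  -- At the last time `s` with `g ≥ ρ`, continuity gives `g ≤ ρ` on all of `[s, b]`, and the
  -- hypothesis then contradicts `g s ≥ ρ > κ`.
  obtain ⟨s, hsS, hmax⟩ := hSc.exists_isGreatest ⟨t₁, ht₁, hgt.le⟩
  have hafter : ∀ t ∈ Ioc s b, g t < ρ := fun t ht => by
    by_contra! hge
    exact absurd (hmax ⟨⟨hsS.1.1.trans ht.1.le, ht.2⟩, hge⟩) (not_le.2 ht.1)
  have hsb : s < b := by
    refine lt_of_le_of_ne hsS.1.2 fun hEq => ?_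
    have : ρ ≤ g s := hsS.2
    rw [hEq] at this
    linarith
  have hgs : g s ≤ ρ := by
    have hcont : ContinuousWithinAt g (Ioc s b) s :=
      (hg s hsS.1).mono (Ioc_subset_Icc_self.trans (Icc_subset_Icc_left hsS.1.1))
    have hcl : s ∈ closure (Ioc s b) := by
      rw [closure_Ioc hsb.ne]; exact left_mem_Icc.2 hsb.le
    exact hcont.closure_le hcl continuousWithinAt_const fun t ht => (hafter t ht).le
  have := h s hsS.1 fun t ht => by
    rcases eq_or_lt_of_le ht.1 with rfl | hlt
    · exact hgs
    · exact (hafter t ⟨hlt, ht.2⟩).le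
  have h2 : ρ ≤ g s := hsS.2
  linarith

omit [DecidableEq n] in
open scoped Matrix.Norms.Operator in
theorem HasDerivWithinAt.matrix_entry {f : ℝ → Matrix n n ℝ} {f' : Matrix n n ℝ} {s : Set ℝ}
    {t : ℝ} (h : HasDerivWithinAt f f' s t) (i j : n) :
    HasDerivWithinAt (fun r => f r i j) (f' i j) s t :=
  ((Matrix.entryLinearMap ℝ ℝ i j).toContinuousLinearMap.hasFDerivAt.comp_hasDerivWithinAt t h)

open scoped Matrix.Norms.Operator in
-- The truncated equation has a global solution `Z`. As long as `‖Z‖ ≤ r + 1` the truncation is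
-- inactive, so the a priori bound applies and improves this to `‖Z‖ ≤ r`; backward continuation
-- then covers the whole interval.
theorem exists_riccati_solution {a b : ℝ} (hab : a ≤ b) {H C M P Pd : ℝ → Matrix n n ℝ}
    (hH : ContinuousOn H (Icc a b)) (hC : ContinuousOn C (Icc a b))
    (hMc : ContinuousOn M (Icc a b)) (hCs : ∀ t ∈ Icc a b, (C t).IsSymm)
    (hM : ∀ t ∈ Icc a b, (M t).PosSemidef)
    (hP : HasEntryDerivOn (Icc a b) P Pd) (hPs : ∀ t ∈ Icc a b, (P t).IsSymm)
    (hle : ∀ t ∈ Icc a b, ∀ v, v ⬝ᵥ riccati (H t) (C t) (M t) (P t) (Pd t) *ᵥ v ≤ 0)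
    (hPb : ∀ v, 0 ≤ v ⬝ᵥ P b *ᵥ v) :
    ∃ Y Yd : ℝ → Matrix n n ℝ, HasEntryDerivOn (Icc a b) Y Yd ∧
      (∀ t ∈ Icc a b, (Y t).IsSymm) ∧ Y b = 0 ∧
      ∀ t ∈ Icc a b, riccati (H t) (C t) (M t) (Y t) (Yd t) = 0 := by
  obtain ⟨κ, hκ, hbound⟩ := exists_riccati_apriori_bound hH hC hMc hM hP hPs hle hPb
  -- The form bound `κ` gives entries of size at most `3κ`, hence a row-sum norm at most `r`. The
  -- clipping radius `r + 1` leaves room for the continuation argument.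
  set r := Fintype.card n * (3 * κ)
  have hr : 0 ≤ r := by positivity
  have hρ : 0 < r + 1 := by positivity
  -- The a priori bound concerns symmetric solutions only. Symmetrising inside the field makes `Zd`
  -- symmetric before `Z` is known to be.
  let σ : Matrix n n ℝ →L[ℝ] Matrix n n ℝ := LinearMap.toContinuousLinearMap
    ((2⁻¹ : ℝ) • (LinearMap.id + (Matrix.transposeLinearEquiv n n ℝ ℝ).toLinearMap))
  have hσ : ∀ X, σ X = (2⁻¹ : ℝ) • (X + Xᵀ) := fun X => rfl
  have hσs : ∀ X : Matrix n n ℝ, X.IsSymm → σ X = X := fun X hX => by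
    rw [hσ, hX.eq, ← two_smul ℝ X, smul_smul]
    norm_num
  have hclip : ∀ X, (radialClip (r + 1) (σ X)).IsSymm := fun X => by
    rw [Matrix.IsSymm, radialClip, hσ, Matrix.transpose_smul, Matrix.transpose_smul,
      Matrix.transpose_add, Matrix.transpose_transpose, add_comm X]
  obtain ⟨Z, hZb, hZ⟩ := exists_truncated_riccati hab (H₁ := fun t => (H t)ᵀ) (H₂ := H) (C := C)
    (M := M) (continuous_id.matrix_transpose.comp_continuousOn hH) hH hC hMc hρ σ
  set Zd : ℝ → Matrix n n ℝ := fun t =>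
    -((H t)ᵀ * radialClip (r + 1) (σ (Z t)) + radialClip (r + 1) (σ (Z t)) * H t + C t
      + radialClip (r + 1) (σ (Z t)) * M t * radialClip (r + 1) (σ (Z t))) with hZd
  have hZe : HasEntryDerivOn (Icc a b) Z Zd := fun t ht i j => (hZ t ht).matrix_entry i j
  have hZds : ∀ t ∈ Icc a b, (Zd t).IsSymm := fun t ht => by
    have hMs : (M t)ᵀ = M t := by simpa using (hM t ht).isHermitian.eq
    simp only [hZd, Matrix.IsSymm, Matrix.transpose_neg, Matrix.transpose_add,
      Matrix.transpose_mul, Matrix.transpose_transpose, (hclip (Z t)).eq, (hCs t ht).eq, hMs]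
    rw [add_comm (radialClip (r + 1) (σ (Z t)) * H t), Matrix.mul_assoc]
  -- The antisymmetric part of `Z` has zero derivative and vanishes at `b`.
  have hZs : ∀ t ∈ Icc a b, (Z t).IsSymm := by
    have hconst : ∀ i j, ∀ t ∈ Icc a b, Z t i j - Z t j i = Z a i j - Z a j i := fun i j => by
      have hd : ∀ t ∈ Icc a b,
          HasDerivWithinAt (fun s => Z s i j - Z s j i) 0 (Icc a b) t := fun t ht => by
        have := (hZe t ht i j).fun_sub (hZe t ht j i)
        rwa [(hZds t ht).apply i j, sub_self] at this
      exact constant_of_has_deriv_right_zero (fun t ht => (hd t ht).continuousWithinAt)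
        (fun t ht => (hd t (Ico_subset_Icc_self ht)).Ici_of_Icc ht)
    intro t ht
    refine Matrix.IsSymm.ext fun i j => ?_
    have h1 := hconst j i t ht
    have h2 := hconst j i b (right_mem_Icc.2 hab)
    rw [hZb] at h2
    simp only [Matrix.zero_apply, sub_self] at h2
    linarith
  have hZc : ContinuousOn Z (Icc a b) := fun t ht => (hZ t ht).continuousWithinAt
  have hric : ∀ t ∈ Icc a b, ‖Z t‖ ≤ r + 1 →
      riccati (H t) (C t) (M t) (Z t) (Zd t) = 0 := fun t ht hn => by
    simp only [hZd, riccati, hσs _ (hZs t ht), radialClip_of_norm_le hρ hn]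
    abel
  have hZle : ∀ t ∈ Icc a b, ‖Z t‖ ≤ r + 1 := by
    refine le_of_backward_apriori_bound (κ := r) hZc.norm (by rw [hZb, norm_zero]; exact hr)
      (by linarith) fun s hs hbd => ?_
    have hsub : Icc s b ⊆ Icc a b := Icc_subset_Icc_left hs.1
    exact norm_le_of_entry_bound (by positivity) (abs_entry_le_of_quadForm_bound (hZs s hs)
      (hbound s hs Z Zd (hZe.mono hsub) (fun t ht => hZs t (hsub ht)) hZb
        (fun t ht => hric t (hsub ht) (hbd t ht))))
  exact ⟨Z, Zd, hZe, hZs, hZb, fun t ht => hric t ht (hZle t ht)⟩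

end RiccatiExistence
end

/-! ### Strict perturbation of the Riccati solution; block algebra of the matrix inequality -/

noncomputable section

open Set

section StrictPerturbation

variable {n : Type*} [Fintype n] [DecidableEq n]

/-- Arbitrarily close above a solution of the Riccati equation with `Y(b) = 0` there is a solution
of the strict Riccati inequality. -/
theorem exists_strict_riccati_near {a b : ℝ} {H C M Y Yd : ℝ → Matrix n n ℝ}
    (hH : ContinuousOn H (Icc a b)) (hMc : ContinuousOn M (Icc a b))
    (hMs : ∀ t ∈ Icc a b, (M t).IsSymm)
    (hY : HasEntryDerivOn (Icc a b) Y Yd) (hYs : ∀ t ∈ Icc a b, (Y t).IsSymm) (hYb : Y b = 0)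
    (hYr : ∀ t ∈ Icc a b, riccati (H t) (C t) (M t) (Y t) (Yd t) = 0) (ξ : n → ℝ) {δ : ℝ}
    (hδ : 0 < δ) :
    ∃ P Pd : ℝ → Matrix n n ℝ, HasEntryDerivOn (Icc a b) P Pd ∧
      (∀ t ∈ Icc a b, (P t).IsSymm) ∧ (P b).PosSemidef ∧
      (∀ t ∈ Icc a b, ∀ v, v ≠ 0 → v ⬝ᵥ riccati (H t) (C t) (M t) (P t) (Pd t) *ᵥ v < 0) ∧
      ξ ⬝ᵥ P a *ᵥ ξ ≤ ξ ⬝ᵥ Y a *ᵥ ξ + δ := by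
  obtain ⟨f, hf, hFb⟩ := exists_quadForm_bound (hH.add (hMc.mul hY.continuousOn))
  obtain ⟨μ, hμ, hMb⟩ := exists_quadForm_bound hMc
  have hξ := dotProduct_self_nonneg_real ξ
  set k := 2 * f + 1 with hk
  set Θ := Real.exp (k * (b - a))
  have hΘ : 0 < Θ := Real.exp_pos _
  -- The perturbation is `cI` with `c(t) = ε exp(k(b - t)) ≤ εΘ`. The first bound yields `cμ < 1`,
  -- so the decay rate `k` beats the drift and the quadratic term; the second keeps the increase at
  -- `a` below `δ`.
  set ε := min (1 / (2 * (Θ * (μ + 1)))) (δ / (Θ * (ξ ⬝ᵥ ξ + 1)))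
  have hε : 0 < ε := by positivity
  have hε₁ : ε * Θ * μ < 1 := by
    have h1 : ε ≤ 1 / (2 * (Θ * (μ + 1))) := min_le_left _ _
    rw [le_div_iff₀ (by positivity)] at h1
    nlinarith [mul_pos hε hΘ, mul_nonneg (mul_pos hε hΘ).le hμ]
  have hε₂ : ε * Θ * (ξ ⬝ᵥ ξ) ≤ δ := by
    have h1 : ε ≤ δ / (Θ * (ξ ⬝ᵥ ξ + 1)) := min_le_right _ _
    rw [le_div_iff₀ (by positivity)] at h1
    nlinarith [mul_pos hε hΘ]
  let c : ℝ → ℝ := fun t => ε * Real.exp (k * (b - t))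
  let D : ℝ → Matrix n n ℝ := fun t => c t • 1
  let Dd : ℝ → Matrix n n ℝ := fun t => (-k * c t) • 1
  have hD : HasEntryDerivOn (Icc a b) D Dd := by
    refine hasEntryDerivOn_smul_one fun t _ => ?_
    have h1 : HasDerivAt (fun t => k * (b - t)) (-k) t := by
      simpa using ((hasDerivAt_id t).const_sub b).const_mul k
    convert! (h1.exp.const_mul ε).hasDerivWithinAt using 1
    simp only [c]
    ring
  have hDs : ∀ t, (D t).IsSymm := fun t => by
    rw [Matrix.IsSymm, Matrix.transpose_smul, Matrix.transpose_one]
  refine ⟨Y + D, Yd + Dd, hY.add hD, fun t ht => (hYs t ht).add (hDs t), ?_, ?_, ?_⟩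
  · rw [Pi.add_apply, hYb, zero_add]
    exact Matrix.PosSemidef.one.smul (by positivity)
  · intro t ht v hv
    have hvv : 0 < v ⬝ᵥ v := by
      simpa using (Matrix.PosDef.one (n := n) (R := ℝ)).dotProduct_mulVec_pos hv
    -- Because `Y` solves the equation, the perturbation obeys an exact Riccati expression with
    -- drift `H + MY` and no constant term.
    have e : riccati (H t) (C t) (M t) ((Y + D) t) ((Yd + Dd) t)
        = riccati (H t + M t * Y t) 0 (M t) (D t) (Dd t) := by
      have h1 := riccati_sub_riccati (H := H t) (C := C t) (P := Y t + D t) (Pd := Yd t + Dd t)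
        (Yd := Yd t) (hMs t ht) (hYs t ht)
      rw [hYr t ht, sub_zero, eq_sub_iff_add_eq, add_sub_cancel_left, add_sub_cancel_left] at h1
      rw [Pi.add_apply, Pi.add_apply, ← h1, riccati, add_zero]
    rw [e, quadForm_riccati_smul_one, Matrix.zero_mulVec, dotProduct_zero, add_zero]
    have h1 := (abs_le.1 (hFb t ht v)).2
    have h2 := (abs_le.1 (hMb t ht v)).2
    have hc : 0 < c t := by positivity
    have hcΘ : c t ≤ ε * Θ := by
      refine mul_le_mul_of_nonneg_left (Real.exp_le_exp.2 ?_) hε.le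
      refine mul_le_mul_of_nonneg_left ?_ (by positivity)
      linarith [ht.1]
    have hcμ : c t * μ < 1 := (mul_le_mul_of_nonneg_right hcΘ hμ).trans_lt hε₁
    have h3 : c t * (v ⬝ᵥ (H t + M t * Y t) *ᵥ v) ≤ c t * (f * (v ⬝ᵥ v)) :=
      mul_le_mul_of_nonneg_left h1 hc.le
    have h4 : c t ^ 2 * (v ⬝ᵥ M t *ᵥ v) ≤ c t ^ 2 * (μ * (v ⬝ᵥ v)) :=
      mul_le_mul_of_nonneg_left h2 (sq_nonneg _)
    have h5 : c t * (v ⬝ᵥ v) * (c t * μ) < c t * (v ⬝ᵥ v) * 1 :=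
      mul_lt_mul_of_pos_left hcμ (mul_pos hc hvv)
    have h6 : -k * c t * (v ⬝ᵥ v) = -(2 * (c t * (f * (v ⬝ᵥ v)))) - c t * (v ⬝ᵥ v) := by
      rw [hk]; ring
    nlinarith
  · simp only [Pi.add_apply, Matrix.add_mulVec, dotProduct_add, D, Matrix.smul_mulVec,
      Matrix.one_mulVec, dotProduct_smul, smul_eq_mul]
    exact add_le_add_right hε₂ _

end StrictPerturbation

section MatrixContinuity

variable {k m n : Type*}

theorem ContinuousOn.matrix_mul_rect [Fintype m] {s : Set ℝ} {X : ℝ → Matrix k m ℝ}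
    {Y : ℝ → Matrix m n ℝ} (hX : ContinuousOn X s) (hY : ContinuousOn Y s) :
    ContinuousOn (fun t => X t * Y t) s := by
  rw [continuousOn_iff_continuous_domRestrict] at *
  exact hX.matrix_mul hY

theorem ContinuousOn.matrix_mulVec_rect [Fintype m] {s : Set ℝ} {X : ℝ → Matrix k m ℝ}
    {y : ℝ → m → ℝ} (hX : ContinuousOn X s) (hy : ContinuousOn y s) :
    ContinuousOn (fun t => X t *ᵥ y t) s := by
  rw [continuousOn_iff_continuous_domRestrict] at *
  exact hX.matrix_mulVec hy

theorem ContinuousOn.matrix_transpose {s : Set ℝ} {X : ℝ → Matrix k m ℝ}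
    (hX : ContinuousOn X s) : ContinuousOn (fun t => (X t)ᵀ) s :=
  continuous_id.matrix_transpose.comp_continuousOn hX

theorem ContinuousOn.matrix_inv [Fintype n] [DecidableEq n] {s : Set ℝ} {X : ℝ → Matrix n n ℝ}
    (hX : ContinuousOn X s) (h : ∀ t ∈ s, (X t).det ≠ 0) :
    ContinuousOn (fun t => (X t)⁻¹) s := by
  simp only [Matrix.inv_def, Ring.inverse_eq_inv']
  exact ((continuous_id.matrix_det.comp_continuousOn hX).inv₀ h).smul
    (continuous_id.matrix_adjugate.comp_continuousOn hX)

end MatrixContinuity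

namespace UncertainLTV

variable {nx nw nv ne m : ℕ} (G : UncertainLTV nx nw nv ne m)

theorem isSymm_Wi (hM : ∀ i, (G.M i).IsSymm) (i : Fin m) (t : ℝ) : (G.Wi i t).IsSymm := by
  rw [Matrix.IsSymm, Wi, Matrix.transpose_mul, Matrix.transpose_mul, Matrix.transpose_transpose,
    (hM i).eq, Matrix.mul_assoc]

theorem isSymm_W (hM : ∀ i, (G.M i).IsSymm) (t : ℝ) (l : Fin m → ℝ) : (G.W t l).IsSymm := by
  refine Matrix.IsSymm.add ?_ ?_
  · rw [Matrix.IsSymm, W0, Matrix.transpose_mul, Matrix.transpose_transpose]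
  · rw [Matrix.IsSymm, Matrix.transpose_sum]
    simp only [Matrix.transpose_smul, (G.isSymm_Wi hM _ t).eq]

theorem W_eq_fromBlocks (hM : ∀ i, (G.M i).IsSymm) (t : ℝ) (l : Fin m → ℝ) :
    G.W t l = Matrix.fromBlocks (G.Q t l) (G.S t l) (G.S t l)ᵀ (G.R t l) := by
  have h : (G.S t l)ᵀ = (G.W t l).toBlocks₂₁ := by
    ext i j
    exact (G.isSymm_W hM t l).apply _ _
  rw [h]
  exact (Matrix.fromBlocks_toBlocks _).symm

theorem isSymm_Q (hM : ∀ i, (G.M i).IsSymm) (t : ℝ) (l : Fin m → ℝ) : (G.Q t l).IsSymm :=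
  Matrix.IsSymm.ext fun _ _ => (G.isSymm_W hM t l).apply _ _

theorem isSymm_R (hM : ∀ i, (G.M i).IsSymm) (t : ℝ) (l : Fin m → ℝ) : (G.R t l).IsSymm :=
  Matrix.IsSymm.ext fun _ _ => (G.isSymm_W hM t l).apply _ _

theorem quadForm_W (hM : ∀ i, (G.M i).IsSymm) (t : ℝ) (l : Fin m → ℝ) (x : Fin nx ⊕ Unit → ℝ)
    (w : Fin nw → ℝ) :
    Sum.elim x w ⬝ᵥ G.W t l *ᵥ Sum.elim x w
      = x ⬝ᵥ G.Q t l *ᵥ x + 2 * (w ⬝ᵥ (G.S t l)ᵀ *ᵥ x) + w ⬝ᵥ G.R t l *ᵥ w := by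
  have h : x ⬝ᵥ G.S t l *ᵥ w = w ⬝ᵥ (G.S t l)ᵀ *ᵥ x := by
    rw [Matrix.dotProduct_mulVec, ← Matrix.mulVec_transpose, dotProduct_comm]
  rw [G.W_eq_fromBlocks hM, Matrix.fromBlocks_mulVec, sumElim_dotProduct_sumElim]
  simp only [Sum.elim_comp_inl, Sum.elim_comp_inr, dotProduct_add, h]
  ring

/-- The quadratic form of the differential linear matrix inequality is the derivative of the
storage function along the system plus the running cost. -/
theorem quadForm_dlmi (t : ℝ) (l : Fin m → ℝ) {P Pd : Matrix (Fin nx ⊕ Unit) (Fin nx ⊕ Unit) ℝ}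
    (x : Fin nx ⊕ Unit → ℝ) (w : Fin nw → ℝ) :
    Sum.elim x w ⬝ᵥ G.dlmi t l P Pd *ᵥ Sum.elim x w
      = (G.Aa t *ᵥ x + G.Ba t *ᵥ w) ⬝ᵥ P *ᵥ x
        + x ⬝ᵥ (Pd *ᵥ x + P *ᵥ (G.Aa t *ᵥ x + G.Ba t *ᵥ w))
        + Sum.elim x w ⬝ᵥ G.W t l *ᵥ Sum.elim x w := by
  rw [dlmi, Matrix.add_mulVec, dotProduct_add, Matrix.fromBlocks_mulVec,
    sumElim_dotProduct_sumElim]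
  have h1 : x ⬝ᵥ (G.Aa t)ᵀ *ᵥ P *ᵥ x = (G.Aa t *ᵥ x) ⬝ᵥ P *ᵥ x := by
    rw [Matrix.dotProduct_mulVec, Matrix.vecMul_transpose]
  have h2 : w ⬝ᵥ (G.Ba t)ᵀ *ᵥ P *ᵥ x = (G.Ba t *ᵥ w) ⬝ᵥ P *ᵥ x := by
    rw [Matrix.dotProduct_mulVec, Matrix.vecMul_transpose]
  simp only [Sum.elim_comp_inl, Sum.elim_comp_inr, Matrix.add_mulVec, Matrix.mulVec_add,
    dotProduct_add, add_dotProduct, ← Matrix.mulVec_mulVec, h1, h2, Matrix.zero_mulVec,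
    dotProduct_zero]
  ring

/-- Completion of the square in the differential linear matrix inequality. -/
theorem quadForm_dlmi_eq_rde_add (hM : ∀ i, (G.M i).IsSymm) (t : ℝ) (l : Fin m → ℝ)
    (hR : IsUnit (G.R t l).det) {P Pd : Matrix (Fin nx ⊕ Unit) (Fin nx ⊕ Unit) ℝ}
    (hP : P.IsSymm) (x : Fin nx ⊕ Unit → ℝ) (w : Fin nw → ℝ) :
    Sum.elim x w ⬝ᵥ G.dlmi t l P Pd *ᵥ Sum.elim x w
      = x ⬝ᵥ G.rde t l P Pd *ᵥ x
        + (w + ((G.R t l)⁻¹ * (P * G.Ba t + G.S t l)ᵀ) *ᵥ x) ⬝ᵥ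
          G.R t l *ᵥ (w + ((G.R t l)⁻¹ * (P * G.Ba t + G.S t l)ᵀ) *ᵥ x) := by
  set z := (P * G.Ba t + G.S t l)ᵀ *ᵥ x with hz
  set y := ((G.R t l)⁻¹ * (P * G.Ba t + G.S t l)ᵀ) *ᵥ x with hy
  have hRy : G.R t l *ᵥ y = z := by
    rw [hy, Matrix.mulVec_mulVec, ← Matrix.mul_assoc, Matrix.mul_nonsing_inv _ hR,
      Matrix.one_mul]
  have hyw : y ⬝ᵥ G.R t l *ᵥ w = w ⬝ᵥ z := by
    rw [(G.isSymm_R hM t l).dotProduct_mulVec_comm, hRy]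
  have hzw : w ⬝ᵥ z = (G.Ba t *ᵥ w) ⬝ᵥ P *ᵥ x + w ⬝ᵥ (G.S t l)ᵀ *ᵥ x := by
    rw [hz, Matrix.transpose_add, Matrix.transpose_mul, hP.eq, Matrix.add_mulVec,
      dotProduct_add, ← Matrix.mulVec_mulVec, Matrix.dotProduct_mulVec w, Matrix.vecMul_transpose]
  have hrde : x ⬝ᵥ G.rde t l P Pd *ᵥ x
      = (G.Aa t *ᵥ x) ⬝ᵥ P *ᵥ x + x ⬝ᵥ (Pd *ᵥ x + P *ᵥ G.Aa t *ᵥ x) + x ⬝ᵥ G.Q t l *ᵥ x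
        - y ⬝ᵥ z := by
    have h1 : x ⬝ᵥ (G.Aa t)ᵀ *ᵥ P *ᵥ x = (G.Aa t *ᵥ x) ⬝ᵥ P *ᵥ x := by
      rw [Matrix.dotProduct_mulVec, Matrix.vecMul_transpose]
    have h2 : x ⬝ᵥ ((P * G.Ba t + G.S t l) * (G.R t l)⁻¹ * (P * G.Ba t + G.S t l)ᵀ) *ᵥ x
        = y ⬝ᵥ z := by
      rw [Matrix.mul_assoc, ← Matrix.mulVec_mulVec, ← hy, Matrix.dotProduct_mulVec,
        ← Matrix.mulVec_transpose, ← hz, dotProduct_comm]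
    rw [rde, Matrix.sub_mulVec, dotProduct_sub, h2]
    simp only [Matrix.add_mulVec, dotProduct_add, ← Matrix.mulVec_mulVec, h1]
    ring
  have hPB : x ⬝ᵥ P *ᵥ G.Ba t *ᵥ w = (G.Ba t *ᵥ w) ⬝ᵥ P *ᵥ x :=
    hP.dotProduct_mulVec_comm _ _
  rw [G.quadForm_dlmi, G.quadForm_W hM, hrde]
  simp only [Matrix.mulVec_add, dotProduct_add, add_dotProduct, hRy, hyw, hPB]
  rw [hzw]
  ring

end UncertainLTV
end

/-! ### Product rule for absolutely continuous curves; integrability -/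

noncomputable section

open Set MeasureTheory

section Primitive

/-- `f` is on `[0, T]` a primitive of the integrable function `f'`. -/
def IsPrimitiveOn (T : ℝ) (f f' : ℝ → ℝ) : Prop :=
  IntervalIntegrable f' volume 0 T ∧ ∀ t ∈ Icc 0 T, f t = f 0 + ∫ s in (0 : ℝ)..t, f' s

variable {T : ℝ} {f f' g g' : ℝ → ℝ}

theorem IntervalIntegrable.mono_left_zero {t : ℝ} (h : IntervalIntegrable f' volume 0 T)
    (ht : t ∈ Icc 0 T) : IntervalIntegrable f' volume 0 t :=
  h.mono_set (uIcc_subset_uIcc left_mem_uIcc (Icc_subset_uIcc ht))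

theorem IsPrimitiveOn.add (hf : IsPrimitiveOn T f f') (hg : IsPrimitiveOn T g g') :
    IsPrimitiveOn T (fun t => f t + g t) (fun t => f' t + g' t) := by
  refine ⟨hf.1.add hg.1, fun t ht => ?_⟩
  beta_reduce
  rw [intervalIntegral.integral_add (hf.1.mono_left_zero ht) (hg.1.mono_left_zero ht),
    hf.2 t ht, hg.2 t ht]
  ring

theorem IsPrimitiveOn.sum {ι : Type*} (s : Finset ι) {F F' : ι → ℝ → ℝ}
    (h : ∀ i ∈ s, IsPrimitiveOn T (F i) (F' i)) :
    IsPrimitiveOn T (fun t => ∑ i ∈ s, F i t) (fun t => ∑ i ∈ s, F' i t) := by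
  classical
  induction s using Finset.induction_on with
  | empty => exact ⟨by simp, fun t _ => by simp⟩
  | insert a s ha ih =>
    simp only [Finset.sum_insert ha]
    exact (h a (Finset.mem_insert_self _ _)).add
      (ih fun i hi => h i (Finset.mem_insert_of_mem hi))

theorem AbsolutelyContinuousOnInterval.const_add {a b : ℝ} (c : ℝ)
    (hf : AbsolutelyContinuousOnInterval f a b) :
    AbsolutelyContinuousOnInterval (fun t => c + f t) a b := by
  have : AbsolutelyContinuousOnInterval (fun _ : ℝ => c) a b :=
    (LipschitzWith.const c).lipschitzOnWith.absolutelyContinuousOnInterval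
  exact this.add hf

/-- An `L₂` input gives trajectories that are differentiable only almost everywhere, so the product
rule is the one for absolutely continuous functions. -/
theorem IsPrimitiveOn.mul (hT : 0 ≤ T) (hf : IsPrimitiveOn T f f') (hg : IsPrimitiveOn T g g') :
    IsPrimitiveOn T (fun t => f t * g t) (fun t => f' t * g t + f t * g' t) := by
  -- Nothing is known of `f` and `g` off `[0, T]`; two-sided derivatives are taken of these
  -- integrals instead.
  set F : ℝ → ℝ := fun t => f 0 + ∫ s in (0 : ℝ)..t, f' s
  set K : ℝ → ℝ := fun t => g 0 + ∫ s in (0 : ℝ)..t, g' s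
  have hfF : ∀ t ∈ Icc 0 T, f t = F t := hf.2
  have hgK : ∀ t ∈ Icc 0 T, g t = K t := hg.2
  have hFac : AbsolutelyContinuousOnInterval F 0 T :=
    (hf.1.absolutelyContinuousOnInterval_intervalIntegral left_mem_uIcc).const_add _
  have hKac : AbsolutelyContinuousOnInterval K 0 T :=
    (hg.1.absolutelyContinuousOnInterval_intervalIntegral left_mem_uIcc).const_add _
  have hint : IntervalIntegrable (fun t => f' t * K t + F t * g' t) volume 0 T :=
    (hf.1.mul_continuousOn hKac.continuousOn).add (hg.1.continuousOn_mul hFac.continuousOn)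
  have hcongr : ∀ t ∈ Icc 0 T, f' t * K t + F t * g' t = f' t * g t + f t * g' t :=
    fun t ht => by rw [hfF t ht, hgK t ht]
  refine ⟨hint.congr fun t ht => ?_, fun t ht => ?_⟩
  · rw [uIoc_of_le hT] at ht
    exact hcongr t (Ioc_subset_Icc_self ht)
  · have h0 : (0 : ℝ) ∈ Icc 0 T := left_mem_Icc.2 hT
    have hsub : uIcc 0 t ⊆ uIcc 0 T := uIcc_subset_uIcc left_mem_uIcc (Icc_subset_uIcc ht)
    have key := (hFac.mono hsub).integral_deriv_mul_eq_sub (hKac.mono hsub)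
    rw [← hfF t ht, ← hgK t ht, ← hfF 0 h0, ← hgK 0 h0] at key
    rw [← sub_eq_iff_eq_add', ← key]
    refine intervalIntegral.integral_congr_ae ?_
    filter_upwards [hf.1.ae_hasDerivAt_integral, hg.1.ae_hasDerivAt_integral] with r hr₁ hr₂ hr
    have hr' : r ∈ uIcc 0 T := hsub (uIoc_subset_uIcc hr)
    have e₁ : deriv F r = f' r := ((hr₁ hr' 0 left_mem_uIcc).const_add _).deriv
    have e₂ : deriv K r = g' r := ((hr₂ hr' 0 left_mem_uIcc).const_add _).deriv
    rw [e₁, e₂]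
    exact hcongr r (by rwa [uIcc_of_le hT] at hr')

theorem isPrimitiveOn_of_hasDerivWithinAt (hT : 0 ≤ T)
    (h : ∀ t ∈ Icc 0 T, HasDerivWithinAt f (f' t) (Icc 0 T) t)
    (hc : ContinuousOn f' (Icc 0 T)) : IsPrimitiveOn T f f' := by
  have hint : IntervalIntegrable f' volume 0 T := hc.intervalIntegrable_of_Icc hT
  refine ⟨hint, fun t ht => ?_⟩
  have hsub : Icc 0 t ⊆ Icc 0 T := Icc_subset_Icc_right ht.2
  rw [intervalIntegral.integral_eq_sub_of_hasDeriv_right_of_le ht.1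
    (fun s hs => (h s (hsub hs)).continuousWithinAt.mono hsub)
    (fun s hs => ((h s (hsub (Ioo_subset_Icc_self hs))).Ici_of_Icc
      ⟨hs.1.le, hs.2.trans_le ht.2⟩).mono Ioi_subset_Ici_self)
    (hint.mono_left_zero ht)]
  ring

variable {n : Type*} [Fintype n]

/-- Product rule for a quadratic form along an absolutely continuous curve. -/
theorem isPrimitiveOn_quadForm (hT : 0 ≤ T) {x x' : ℝ → n → ℝ} {Y Yd : ℝ → Matrix n n ℝ}
    (hx : ∀ i, IsPrimitiveOn T (fun t => x t i) (fun t => x' t i))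
    (hY : ∀ i j, IsPrimitiveOn T (fun t => Y t i j) (fun t => Yd t i j)) :
    IsPrimitiveOn T (fun t => x t ⬝ᵥ Y t *ᵥ x t)
      (fun t => x' t ⬝ᵥ Y t *ᵥ x t + x t ⬝ᵥ (Yd t *ᵥ x t + Y t *ᵥ x' t)) := by
  have h := IsPrimitiveOn.sum Finset.univ fun i _ => (hx i).mul hT
    (IsPrimitiveOn.sum Finset.univ fun j _ => (hY i j).mul hT (hx j))
  simpa only [dotProduct, Matrix.mulVec, Pi.add_apply, Finset.sum_add_distrib] using h

end Primitive

section Integrability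

variable {k : Type*} [Fintype k] {T : ℝ}

theorem ContinuousOn.memLp_Icc {E : Type*} [NormedAddCommGroup E] [SecondCountableTopology E]
    {f : ℝ → E} {a b : ℝ} (hf : ContinuousOn f (Icc a b)) (p : ENNReal) :
    MemLp f p (volume.restrict (Icc a b)) := by
  obtain ⟨c, -, hc⟩ := exists_norm_bound_Icc hf
  exact MemLp.of_bound (hf.aestronglyMeasurable measurableSet_Icc) c
    (ae_restrict_of_forall_mem measurableSet_Icc hc)

theorem integrableOn_quadForm {z : ℝ → k → ℝ} {V : ℝ → Matrix k k ℝ}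
    (hz : ∀ i, MemLp (fun t => z t i) 2 (volume.restrict (Icc 0 T)))
    (hV : ContinuousOn V (Icc 0 T)) :
    IntegrableOn (fun t => z t ⬝ᵥ V t *ᵥ z t) (Icc 0 T) := by
  simp only [dotProduct, Matrix.mulVec, Finset.mul_sum]
  refine integrable_finsetSum _ fun i _ => integrable_finsetSum _ fun j _ => ?_
  have hij : IntegrableOn (fun t => z t i * z t j) (Icc 0 T) := (hz i).integrable_mul (hz j)
  have hc : ContinuousOn (fun t => V t i j) (Icc 0 T) :=
    continuousOn_pi.1 (continuousOn_pi.1 hV i) j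
  refine (hij.continuousOn_mul hc isCompact_Icc).congr (Filter.Eventually.of_forall fun t => ?_)
  ring

end Integrability
end

/-! ### From the matrix inequality to the Riccati equation: the value of `J` -/

noncomputable section

open Set MeasureTheory

namespace UncertainLTV

variable {nx nw nv ne m : ℕ} (G : UncertainLTV nx nw nv ne m)

theorem continuousOn_W (hM : ∀ i, (G.M i).IsSymm) {T : ℝ} {l : Fin m → ℝ}
    (hQ : ContinuousOn (fun t => G.Q t l) (Icc 0 T))
    (hS : ContinuousOn (fun t => G.S t l) (Icc 0 T))
    (hR : ContinuousOn (fun t => G.R t l) (Icc 0 T)) :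
    ContinuousOn (fun t => G.W t l) (Icc 0 T) := by
  simp only [fun t => G.W_eq_fromBlocks hM t l]
  rw [continuousOn_iff_continuous_domRestrict] at *
  exact hQ.matrix_fromBlocks hS hS.matrix_transpose hR

theorem W_eq_W_add_sum (t : ℝ) (α l : Fin m → ℝ) :
    G.W t α = G.W t l + ∑ i, (α i - l i) • G.Wi i t := by
  simp only [W, sub_smul, Finset.sum_sub_distrib]
  abel

/-- Only the combinations `W(·, α)` are assumed continuous; each `W_i` is the difference of those at
the unit vector and at zero. -/
theorem continuousOn_Wi {T : ℝ} (hW : ∀ α, ContinuousOn (fun t => G.W t α) (Icc 0 T))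
    (i : Fin m) : ContinuousOn (fun t => G.Wi i t) (Icc 0 T) := by
  refine ((hW (Pi.single i 1)).sub (hW 0)).congr fun t _ => ?_
  rw [Pi.sub_apply, G.W_eq_W_add_sum t (Pi.single i 1) 0, add_sub_cancel_left,
    Finset.sum_eq_single i (fun j _ hj => by simp [hj]) (by simp)]
  simp

/-- The lower right block of the matrix inequality contains no `P`: it is `R` alone. -/
theorem posDef_neg_R {T : ℝ} {l : Fin m → ℝ}
    {P : ℝ → Matrix (Fin nx ⊕ Unit) (Fin nx ⊕ Unit) ℝ} (hP : G.IsFeasible T l P) {t : ℝ}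
    (ht : t ∈ Icc 0 T) : (-G.R t l).PosDef := by
  obtain ⟨-, -, Pd, -, hneg⟩ := hP
  have h := (hneg t ht).submatrix (e := (Sum.inr : Fin nw → (Fin nx ⊕ Unit) ⊕ Fin nw))
    Sum.inr_injective
  convert! h using 1
  ext i j
  simp [dlmi, R, Matrix.toBlocks₂₂]

/-- Standing consequences of the feasibility of the dual problem. -/
structure IsRegular (T : ℝ) (l : Fin m → ℝ) : Prop where
  symm : ∀ i, (G.M i).IsSymm
  contA : ContinuousOn G.Aa (Icc 0 T)
  contB : ContinuousOn G.Ba (Icc 0 T)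
  contQ : ContinuousOn (fun t => G.Q t l) (Icc 0 T)
  contS : ContinuousOn (fun t => G.S t l) (Icc 0 T)
  contR : ContinuousOn (fun t => G.R t l) (Icc 0 T)
  negDef : ∀ t ∈ Icc 0 T, (-G.R t l).PosDef

/-- The drift `A_a - B_a R⁻¹ Sᵀ`. -/
def ricH (l : Fin m → ℝ) (t : ℝ) : Matrix (Fin nx ⊕ Unit) (Fin nx ⊕ Unit) ℝ :=
  G.Aa t - G.Ba t * (G.R t l)⁻¹ * (G.S t l)ᵀ

/-- The constant term `Q - S R⁻¹ Sᵀ`. -/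
def ricC (l : Fin m → ℝ) (t : ℝ) : Matrix (Fin nx ⊕ Unit) (Fin nx ⊕ Unit) ℝ :=
  G.Q t l - G.S t l * (G.R t l)⁻¹ * (G.S t l)ᵀ

/-- The quadratic coefficient `-B_a R⁻¹ B_aᵀ`. -/
def ricM (l : Fin m → ℝ) (t : ℝ) : Matrix (Fin nx ⊕ Unit) (Fin nx ⊕ Unit) ℝ :=
  -(G.Ba t * (G.R t l)⁻¹ * (G.Ba t)ᵀ)

theorem rde_eq_riccati (hM : ∀ i, (G.M i).IsSymm) (t : ℝ) (l : Fin m → ℝ)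
    {P : Matrix (Fin nx ⊕ Unit) (Fin nx ⊕ Unit) ℝ} (hP : P.IsSymm)
    (Pd : Matrix (Fin nx ⊕ Unit) (Fin nx ⊕ Unit) ℝ) :
    G.rde t l P Pd = riccati (G.ricH l t) (G.ricC l t) (G.ricM l t) P Pd := by
  rw [rde, riccati, ricH, ricC, ricM]
  simp only [Matrix.transpose_sub, Matrix.transpose_add, Matrix.transpose_mul,
    Matrix.transpose_transpose, Matrix.transpose_nonsing_inv, (G.isSymm_R hM t l).eq, hP.eq,
    Matrix.add_mul, Matrix.mul_add, Matrix.sub_mul, Matrix.mul_sub, Matrix.mul_neg,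
    Matrix.neg_mul, Matrix.mul_assoc]
  abel

namespace IsRegular

variable {G} {T : ℝ} {l : Fin m → ℝ}

theorem isUnit_det_R (h : G.IsRegular T l) {t : ℝ} (ht : t ∈ Icc 0 T) : IsUnit (G.R t l).det := by
  have h1 := (Matrix.isUnit_iff_isUnit_det _).1 (h.negDef t ht).isUnit
  rw [Matrix.det_neg] at h1
  exact isUnit_of_mul_isUnit_right h1

theorem quadForm_R_nonpos (h : G.IsRegular T l) {t : ℝ} (ht : t ∈ Icc 0 T) (v : Fin nw → ℝ) :
    v ⬝ᵥ G.R t l *ᵥ v ≤ 0 := by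
  have h1 := (h.negDef t ht).posSemidef.dotProduct_mulVec_nonneg v
  rw [star_trivial, Matrix.neg_mulVec, dotProduct_neg] at h1
  linarith

theorem quadForm_R_neg (h : G.IsRegular T l) {t : ℝ} (ht : t ∈ Icc 0 T) {v : Fin nw → ℝ} (hv : v ≠ 0) :
    v ⬝ᵥ G.R t l *ᵥ v < 0 := by
  have h1 := (h.negDef t ht).dotProduct_mulVec_pos hv
  rw [star_trivial, Matrix.neg_mulVec, dotProduct_neg] at h1
  linarith

theorem continuousOn_R_inv (h : G.IsRegular T l) : ContinuousOn (fun t => (G.R t l)⁻¹) (Icc 0 T) :=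
  h.contR.matrix_inv fun _ ht => (h.isUnit_det_R ht).ne_zero

theorem continuousOn_ricH (h : G.IsRegular T l) : ContinuousOn (G.ricH l) (Icc 0 T) :=
  h.contA.sub ((h.contB.matrix_mul_rect h.continuousOn_R_inv).matrix_mul_rect
    h.contS.matrix_transpose)

theorem continuousOn_ricC (h : G.IsRegular T l) : ContinuousOn (G.ricC l) (Icc 0 T) :=
  h.contQ.sub ((h.contS.matrix_mul_rect h.continuousOn_R_inv).matrix_mul_rect
    h.contS.matrix_transpose)

theorem continuousOn_ricM (h : G.IsRegular T l) : ContinuousOn (G.ricM l) (Icc 0 T) :=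
  ((h.contB.matrix_mul_rect h.continuousOn_R_inv).matrix_mul_rect h.contB.matrix_transpose).neg

theorem continuousOn_W (h : G.IsRegular T l) : ContinuousOn (fun t => G.W t l) (Icc 0 T) :=
  G.continuousOn_W h.symm h.contQ h.contS h.contR

theorem posSemidef_ricM (h : G.IsRegular T l) {t : ℝ} (ht : t ∈ Icc 0 T) : (G.ricM l t).PosSemidef := by
  have h1 := (h.negDef t ht).inv.posSemidef.mul_mul_conjTranspose_same (G.Ba t)
  have h2 : (-G.R t l)⁻¹ = -(G.R t l)⁻¹ := by
    refine Matrix.inv_eq_right_inv ?_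
    rw [neg_mul_neg, Matrix.mul_nonsing_inv _ (h.isUnit_det_R ht)]
  rwa [h2, Matrix.mul_neg, Matrix.neg_mul, Matrix.conjTranspose_eq_transpose_of_trivial] at h1

theorem isSymm_ricM (h : G.IsRegular T l) {t : ℝ} (ht : t ∈ Icc 0 T) : (G.ricM l t).IsSymm := by
  simpa using (h.posSemidef_ricM ht).isHermitian

theorem isSymm_ricC (h : G.IsRegular T l) (t : ℝ) : (G.ricC l t).IsSymm := by
  rw [Matrix.IsSymm, ricC]
  simp only [Matrix.transpose_sub, Matrix.transpose_mul, Matrix.transpose_transpose,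
    Matrix.transpose_nonsing_inv, (G.isSymm_R h.symm t l).eq, (G.isSymm_Q h.symm t l).eq,
    Matrix.mul_assoc]

/-- A feasible matrix function satisfies the Riccati inequality. -/
theorem quadForm_rde_nonpos (h : G.IsRegular T l) {P Pd : Matrix (Fin nx ⊕ Unit) (Fin nx ⊕ Unit) ℝ} {t : ℝ}
    (ht : t ∈ Icc 0 T) (hP : P.IsSymm) (hneg : (-G.dlmi t l P Pd).PosDef)
    (x : Fin nx ⊕ Unit → ℝ) : x ⬝ᵥ G.rde t l P Pd *ᵥ x ≤ 0 := by
  -- This input makes the completed square vanish, leaving exactly the Riccati form.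
  set w := -(((G.R t l)⁻¹ * (P * G.Ba t + G.S t l)ᵀ) *ᵥ x)
  have h1 := hneg.posSemidef.dotProduct_mulVec_nonneg (Sum.elim x w)
  have h2 := G.quadForm_dlmi_eq_rde_add h.symm t l (h.isUnit_det_R ht) (Pd := Pd) hP x w
  rw [neg_add_cancel, zero_dotProduct, add_zero] at h2
  rw [star_trivial, Matrix.neg_mulVec, dotProduct_neg, h2] at h1
  linarith

theorem isSymm_dlmi (h : G.IsRegular T l) {P Pd : Matrix (Fin nx ⊕ Unit) (Fin nx ⊕ Unit) ℝ} {t : ℝ}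
    (hP : P.IsSymm) (hPd : Pd.IsSymm) : (G.dlmi t l P Pd).IsSymm := by
  refine Matrix.IsSymm.add ?_ (G.isSymm_W h.symm t l)
  rw [Matrix.IsSymm, Matrix.fromBlocks_transpose]
  simp only [Matrix.transpose_add, Matrix.transpose_mul, Matrix.transpose_transpose, hP.eq,
    hPd.eq, Matrix.transpose_zero]
  rw [add_assoc, add_comm (P * G.Aa t), ← add_assoc]

/-- The strict Riccati inequality implies the differential linear matrix inequality. -/
theorem posDef_neg_dlmi (h : G.IsRegular T l) {P Pd : Matrix (Fin nx ⊕ Unit) (Fin nx ⊕ Unit) ℝ} {t : ℝ}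
    (ht : t ∈ Icc 0 T) (hP : P.IsSymm) (hPd : Pd.IsSymm)
    (hneg : ∀ x, x ≠ 0 → x ⬝ᵥ G.rde t l P Pd *ᵥ x < 0) : (-G.dlmi t l P Pd).PosDef := by
  refine Matrix.PosDef.of_dotProduct_mulVec_pos ?_ fun z hz => ?_
  · rw [Matrix.IsHermitian, Matrix.conjTranspose_eq_transpose_of_trivial, Matrix.transpose_neg,
      (h.isSymm_dlmi hP hPd).eq]
  · obtain ⟨x, w, rfl⟩ : ∃ x w, z = Sum.elim x w := ⟨_, _, (Sum.elim_comp_inl_inr z).symm⟩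
    rw [star_trivial, Matrix.neg_mulVec, dotProduct_neg, neg_pos,
      G.quadForm_dlmi_eq_rde_add h.symm t l (h.isUnit_det_R ht) hP]
    -- Strictness comes from `R` when `x = 0`, and from the Riccati inequality otherwise.
    by_cases hx : x = 0
    · subst hx
      have hw : w ≠ 0 := by
        rintro rfl
        exact hz (by ext i; cases i <;> rfl)
      simpa using h.quadForm_R_neg ht hw
    · exact add_neg_of_neg_of_nonpos (hneg x hx) (h.quadForm_R_nonpos ht _)

theorem exists_isRDESolution (h : G.IsRegular T l) (hT : 0 ≤ T)
    {P : ℝ → Matrix (Fin nx ⊕ Unit) (Fin nx ⊕ Unit) ℝ} (hP : G.IsFeasible T l P) :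
    ∃ Y, G.IsRDESolution T l Y := by
  obtain ⟨hPs, hPT, Pd, hPd, hneg⟩ := hP
  obtain ⟨Y, Yd, hY, hYs, hYT, hYr⟩ := exists_riccati_solution hT h.continuousOn_ricH
    h.continuousOn_ricC h.continuousOn_ricM (fun t _ => h.isSymm_ricC t)
    (fun t ht => h.posSemidef_ricM ht) (P := P) (Pd := Pd) hPd hPs
    (fun t ht v => by
      rw [← G.rde_eq_riccati h.symm t l (hPs t ht)]
      exact h.quadForm_rde_nonpos ht (hPs t ht) (hneg t ht) v)
    (fun v => by simpa using hPT.dotProduct_mulVec_nonneg v)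
  exact ⟨Y, hYs, hYT, Yd, hY, fun t ht => by
    rw [G.rde_eq_riccati h.symm t l (hYs t ht)]; exact hYr t ht⟩

/-- A solution of the Riccati equation lies below every solution of the Riccati inequality with
positive semidefinite final value. -/
theorem rdeSolution_le (h : G.IsRegular T l) {Y P Pd : ℝ → Matrix (Fin nx ⊕ Unit) (Fin nx ⊕ Unit) ℝ}
    (hY : G.IsRDESolution T l Y) (hPs : ∀ t ∈ Icc 0 T, (P t).IsSymm)
    (hPT : (P T).PosSemidef) (hP : IsMatrixDeriv T P Pd)
    (hle : ∀ t ∈ Icc 0 T, ∀ x, x ⬝ᵥ G.rde t l (P t) (Pd t) *ᵥ x ≤ 0) {t : ℝ}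
    (ht : t ∈ Icc 0 T) (x : Fin nx ⊕ Unit → ℝ) : x ⬝ᵥ Y t *ᵥ x ≤ x ⬝ᵥ P t *ᵥ x := by
  obtain ⟨hYs, hYT, Yd, hYd, hYr⟩ := hY
  have hsub : Icc t T ⊆ Icc 0 T := Icc_subset_Icc_left ht.1
  refine riccati_comparison ht.2 (H := G.ricH l) (C := G.ricC l) (M := G.ricM l) (Pd := Pd)
    (Yd := Yd) (h.continuousOn_ricH.mono hsub) (h.continuousOn_ricM.mono hsub)
    (fun s hs => h.posSemidef_ricM (hsub hs)) (HasEntryDerivOn.mono hP hsub)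
    (fun s hs => hPs s (hsub hs)) (HasEntryDerivOn.mono hYd hsub)
    (fun s hs => hYs s (hsub hs)) (fun s hs v => ?_) (fun v => ?_) x
  · rw [← G.rde_eq_riccati h.symm s l (hPs s (hsub hs)),
      ← G.rde_eq_riccati h.symm s l (hYs s (hsub hs)), hYr s (hsub hs), Matrix.zero_mulVec,
      dotProduct_zero]
    exact hle s (hsub hs) v
  · rw [hYT, Matrix.zero_mulVec, dotProduct_zero]
    simpa using hPT.dotProduct_mulVec_nonneg v

/-- Each solution also solves the Riccati inequality with final value `0 ⪰ 0`, so comparison applies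
in both directions. -/
theorem rdeSolution_unique (h : G.IsRegular T l) {Y Y' : ℝ → Matrix (Fin nx ⊕ Unit) (Fin nx ⊕ Unit) ℝ}
    (hY : G.IsRDESolution T l Y) (hY' : G.IsRDESolution T l Y') : EqOn Y' Y (Icc 0 T) := by
  have key : ∀ {Y₁ Y₂ : ℝ → Matrix (Fin nx ⊕ Unit) (Fin nx ⊕ Unit) ℝ},
      G.IsRDESolution T l Y₁ → G.IsRDESolution T l Y₂ → ∀ t ∈ Icc 0 T, ∀ x,
        x ⬝ᵥ Y₁ t *ᵥ x ≤ x ⬝ᵥ Y₂ t *ᵥ x := fun h₁ h₂ t ht x => by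
    obtain ⟨hs, hT, Yd, hd, hr⟩ := h₂
    refine h.rdeSolution_le h₁ hs (by rw [hT]; exact Matrix.PosSemidef.zero) hd
      (fun s hs x => ?_) ht x
    rw [hr s hs, Matrix.zero_mulVec, dotProduct_zero]
  intro t ht
  have hsymm : (Y' t - Y t).IsSymm := (hY'.1 t ht).sub (hY.1 t ht)
  have hzero := abs_entry_le_of_quadForm_bound hsymm (c := 0) fun v => by
    rw [Matrix.sub_mulVec, dotProduct_sub,
      le_antisymm (key hY' hY t ht v) (key hY hY' t ht v)]
    simp
  ext i j
  have := hzero i j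
  rw [mul_zero, abs_nonpos_iff] at this
  exact sub_eq_zero.1 this

theorem J_eq (h : G.IsRegular T l) (hT : 0 < T) {Y : ℝ → Matrix (Fin nx ⊕ Unit) (Fin nx ⊕ Unit) ℝ}
    (hY : G.IsRDESolution T l Y) :
    G.J T l = ((xInit nx ⬝ᵥ Y 0 *ᵥ xInit nx : ℝ) : EReal) := by
  refine le_antisymm ?_ (le_iInf₂ fun P hP => ?_)
  · by_contra! hlt
    obtain ⟨r, hr₁, hr₂⟩ := EReal.lt_iff_exists_real_btwn.1 hlt
    rw [EReal.coe_lt_coe_iff] at hr₁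
    refine absurd hr₂ (not_lt.2 ?_)
    obtain ⟨hYs, hYT, Yd, hYd, hYr⟩ := hY
    obtain ⟨P, Pd, hP, hPs, hPT, hPr, hP0⟩ := exists_strict_riccati_near h.continuousOn_ricH
      h.continuousOn_ricM (C := G.ricC l) (fun t ht => h.isSymm_ricM ht) (Yd := Yd) hYd hYs hYT
      (fun t ht => by rw [← G.rde_eq_riccati h.symm t l (hYs t ht)]; exact hYr t ht)
      (xInit nx) (sub_pos.2 hr₁)
    have hfeas : G.IsFeasible T l P := by
      refine ⟨hPs, hPT, Pd, hP, fun t ht => h.posDef_neg_dlmi ht (hPs t ht) ?_ fun x hx => ?_⟩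
      -- Positive definiteness includes symmetry, so the derivative must be symmetric too; here `0 <
      -- T` is used.
      · exact hP.isSymm_deriv hT hPs t ht
      · rw [G.rde_eq_riccati h.symm t l (hPs t ht)]
        exact hPr t ht x hx
    refine (iInf₂_le P hfeas).trans (EReal.coe_le_coe_iff.2 ?_)
    linarith
  · obtain ⟨hPs, hPT, Pd, hPd, hneg⟩ := hP
    exact EReal.coe_le_coe_iff.2 (h.rdeSolution_le hY hPs hPT hPd
      (fun t ht x => h.quadForm_rde_nonpos ht (hPs t ht) (hneg t ht) x) (left_mem_Icc.2 hT.le) _)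

end IsRegular

end UncertainLTV
end

/-! ### The linear-quadratic problem and its optimal feedback -/

noncomputable section

open Set MeasureTheory

namespace UncertainLTV

variable {nx nw nv ne m : ℕ} {G : UncertainLTV nx nw nv ne m} {T : ℝ} {l : Fin m → ℝ}

theorem IsAdmissible.isPrimitiveOn {x : ℝ → Fin nx ⊕ Unit → ℝ} {w : ℝ → Fin nw → ℝ}
    (h : G.IsAdmissible T x w) (i : Fin nx ⊕ Unit) :
    IsPrimitiveOn T (fun t => x t i) (fun t => (G.Aa t *ᵥ x t + G.Ba t *ᵥ w t) i) := by
  obtain ⟨-, -, hint, hx⟩ := h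
  let π : (Fin nx ⊕ Unit → ℝ) →L[ℝ] ℝ := ContinuousLinearMap.proj i
  have hi : IntervalIntegrable (fun t => (G.Aa t *ᵥ x t + G.Ba t *ᵥ w t) i) volume 0 T :=
    ⟨π.integrable_comp hint.1, π.integrable_comp hint.2⟩
  refine ⟨hi, fun t ht => ?_⟩
  have h0 : x 0 = xInit nx := by
    simpa using hx 0 (left_mem_Icc.2 (ht.1.trans ht.2))
  beta_reduce
  rw [h0, hx t ht, Pi.add_apply]
  congr 1
  exact (π.intervalIntegral_comp_comm (hint.mono_set
    (uIcc_subset_uIcc left_mem_uIcc (Icc_subset_uIcc ht)))).symm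

theorem IsAdmissible.apply_zero (hT : 0 ≤ T) {x : ℝ → Fin nx ⊕ Unit → ℝ}
    {w : ℝ → Fin nw → ℝ} (h : G.IsAdmissible T x w) : x 0 = xInit nx := by
  simpa using h.2.2.2 0 (left_mem_Icc.2 hT)

theorem IsAdmissible.intervalIntegrable_quadForm (hT : 0 ≤ T) {x : ℝ → Fin nx ⊕ Unit → ℝ}
    {w : ℝ → Fin nw → ℝ} (h : G.IsAdmissible T x w)
    {V : ℝ → Matrix ((Fin nx ⊕ Unit) ⊕ Fin nw) ((Fin nx ⊕ Unit) ⊕ Fin nw) ℝ}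
    (hV : ContinuousOn V (Icc 0 T)) :
    IntervalIntegrable (fun t => Sum.elim (x t) (w t) ⬝ᵥ V t *ᵥ Sum.elim (x t) (w t))
      volume 0 T := by
  rw [intervalIntegrable_iff_integrableOn_Icc_of_le hT]
  refine integrableOn_quadForm (fun i => ?_) hV
  rcases i with i | i
  · exact (continuousOn_pi.1 h.2.1 i).memLp_Icc 2
  · exact (ContinuousLinearMap.proj (R := ℝ) (φ := fun _ : Fin nw => ℝ) i).comp_memLp' h.1

/-- The cost splits into a constant and a nonpositive term, which vanishes under the feedback. -/
theorem IsRegular.lqCost_eq (h : G.IsRegular T l) (hT : 0 ≤ T)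
    {Y : ℝ → Matrix (Fin nx ⊕ Unit) (Fin nx ⊕ Unit) ℝ} (hY : G.IsRDESolution T l Y)
    {x : ℝ → Fin nx ⊕ Unit → ℝ} {w : ℝ → Fin nw → ℝ} (hxw : G.IsAdmissible T x w) :
    G.lqCost T l x w = xInit nx ⬝ᵥ Y 0 *ᵥ xInit nx
      + ∫ t in (0 : ℝ)..T, (w t - G.feedback l Y x t) ⬝ᵥ
          G.R t l *ᵥ (w t - G.feedback l Y x t) := by
  obtain ⟨hYs, hYT, Yd, hYd, hYr⟩ := hY
  have hYc : ContinuousOn Y (Icc 0 T) := HasEntryDerivOn.continuousOn hYd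
  -- The Riccati equation expresses `Yd` through continuous data; this makes `Y` the integral of its
  -- derivative.
  have hYdc : ContinuousOn Yd (Icc 0 T) := by
    have hE : ContinuousOn (fun t => Y t * G.Ba t + G.S t l) (Icc 0 T) :=
      (hYc.matrix_mul_rect h.contB).add h.contS
    have hc := (((h.contA.matrix_transpose.matrix_mul_rect hYc).add
      (hYc.matrix_mul_rect h.contA)).add h.contQ).sub
      ((hE.matrix_mul_rect h.continuousOn_R_inv).matrix_mul_rect hE.matrix_transpose)
    refine hc.neg.congr fun t ht => ?_
    have := hYr t ht
    rw [rde] at this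
    rw [Pi.neg_apply, eq_neg_iff_add_eq_zero, ← this]
    simp only [Pi.add_apply, Pi.sub_apply]
    abel
  have hq := isPrimitiveOn_quadForm hT hxw.isPrimitiveOn (Y := Y) (Yd := Yd) fun i j =>
    isPrimitiveOn_of_hasDerivWithinAt hT (fun t ht => hYd t ht i j)
      (continuousOn_pi.1 (continuousOn_pi.1 hYdc i) j)
  -- The boundary term at `T` vanishes because `Y T = 0`, so the integral of the derivative of
  -- `xᵀYx` is `-eᵀY(0)e`.
  have hqT := hq.2 T (right_mem_Icc.2 hT)
  simp only [hYT, Matrix.zero_mulVec, dotProduct_zero, hxw.apply_zero hT] at hqT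
  have hW := hxw.intervalIntegrable_quadForm hT h.continuousOn_W
  have hpt : ∀ t ∈ uIcc 0 T, (w t - G.feedback l Y x t) ⬝ᵥ
      G.R t l *ᵥ (w t - G.feedback l Y x t)
      = ((G.Aa t *ᵥ x t + G.Ba t *ᵥ w t) ⬝ᵥ Y t *ᵥ x t
        + x t ⬝ᵥ (Yd t *ᵥ x t + Y t *ᵥ (G.Aa t *ᵥ x t + G.Ba t *ᵥ w t)))
        + Sum.elim (x t) (w t) ⬝ᵥ G.W t l *ᵥ Sum.elim (x t) (w t) := fun t ht => by
    rw [uIcc_of_le hT] at ht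
    rw [← G.quadForm_dlmi, G.quadForm_dlmi_eq_rde_add h.symm t l (h.isUnit_det_R ht) (hYs t ht),
      hYr t ht, Matrix.zero_mulVec, dotProduct_zero, zero_add, feedback, sub_neg_eq_add]
  rw [intervalIntegral.integral_congr hpt, intervalIntegral.integral_add hq.1 hW, lqCost,
    quadCost]
  linarith

theorem IsRegular.lqCost_le (h : G.IsRegular T l) (hT : 0 ≤ T)
    {Y : ℝ → Matrix (Fin nx ⊕ Unit) (Fin nx ⊕ Unit) ℝ} (hY : G.IsRDESolution T l Y)
    {x : ℝ → Fin nx ⊕ Unit → ℝ} {w : ℝ → Fin nw → ℝ} (hxw : G.IsAdmissible T x w) :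
    G.lqCost T l x w ≤ xInit nx ⬝ᵥ Y 0 *ᵥ xInit nx := by
  rw [h.lqCost_eq hT hY hxw]
  refine add_le_of_nonpos_right ?_
  rw [← neg_nonneg, ← intervalIntegral.integral_neg]
  exact intervalIntegral.integral_nonneg hT fun t ht =>
    neg_nonneg.2 (h.quadForm_R_nonpos ht _)

theorem IsRegular.lqCost_feedback (h : G.IsRegular T l) (hT : 0 ≤ T)
    {Y : ℝ → Matrix (Fin nx ⊕ Unit) (Fin nx ⊕ Unit) ℝ} (hY : G.IsRDESolution T l Y)
    {x : ℝ → Fin nx ⊕ Unit → ℝ} (hx : G.IsAdmissible T x (G.feedback l Y x)) :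
    G.lqCost T l x (G.feedback l Y x) = xInit nx ⬝ᵥ Y 0 *ᵥ xInit nx := by
  rw [h.lqCost_eq hT hY hx]
  simp

theorem IsRDESolution.continuousOn {Y : ℝ → Matrix (Fin nx ⊕ Unit) (Fin nx ⊕ Unit) ℝ}
    (hY : G.IsRDESolution T l Y) : ContinuousOn Y (Icc 0 T) := by
  obtain ⟨-, -, Yd, hYd, -⟩ := hY
  exact HasEntryDerivOn.continuousOn hYd

theorem IsRegular.continuousOn_gain (h : G.IsRegular T l)
    {Y : ℝ → Matrix (Fin nx ⊕ Unit) (Fin nx ⊕ Unit) ℝ} (hY : G.IsRDESolution T l Y) :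
    ContinuousOn (fun t => (G.R t l)⁻¹ * (Y t * G.Ba t + G.S t l)ᵀ) (Icc 0 T) :=
  h.continuousOn_R_inv.matrix_mul_rect
    ((hY.continuousOn.matrix_mul_rect h.contB).add h.contS).matrix_transpose

theorem IsRegular.continuousOn_closedLoop (h : G.IsRegular T l)
    {Y : ℝ → Matrix (Fin nx ⊕ Unit) (Fin nx ⊕ Unit) ℝ} (hY : G.IsRDESolution T l Y) :
    ContinuousOn (fun t => G.Aa t - G.Ba t * (G.R t l)⁻¹ * (Y t * G.Ba t + G.S t l)ᵀ)
      (Icc 0 T) := by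
  simp only [Matrix.mul_assoc]
  exact h.contA.sub (h.contB.matrix_mul_rect (h.continuousOn_gain hY))

theorem IsRegular.exists_isClosedLoop (h : G.IsRegular T l) (hT : 0 ≤ T)
    {Y : ℝ → Matrix (Fin nx ⊕ Unit) (Fin nx ⊕ Unit) ℝ} (hY : G.IsRDESolution T l Y) :
    ∃ x, G.IsClosedLoop T l Y x :=
  exists_linear_solution hT (h.continuousOn_closedLoop hY) (xInit nx)

theorem IsRegular.isClosedLoop_unique (h : G.IsRegular T l)
    {Y : ℝ → Matrix (Fin nx ⊕ Unit) (Fin nx ⊕ Unit) ℝ} (hY : G.IsRDESolution T l Y)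
    {x x' : ℝ → Fin nx ⊕ Unit → ℝ} (hx : G.IsClosedLoop T l Y x)
    (hx' : G.IsClosedLoop T l Y x') : EqOn x' x (Icc 0 T) :=
  linear_solution_unique (h.continuousOn_closedLoop hY) hx'.2 hx.2 (hx'.1.trans hx.1.symm)

theorem IsRegular.isAdmissible_feedback (h : G.IsRegular T l) (hT : 0 ≤ T)
    {Y : ℝ → Matrix (Fin nx ⊕ Unit) (Fin nx ⊕ Unit) ℝ} (hY : G.IsRDESolution T l Y)
    {x : ℝ → Fin nx ⊕ Unit → ℝ} (hx : G.IsClosedLoop T l Y x) :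
    G.IsAdmissible T x (G.feedback l Y x) := by
  obtain ⟨hx0, hd⟩ := hx
  have hxc : ContinuousOn x (Icc 0 T) := fun t ht => (hd t ht).continuousWithinAt
  have hwc : ContinuousOn (G.feedback l Y x) (Icc 0 T) :=
    ((h.continuousOn_gain hY).matrix_mulVec_rect hxc).neg
  have hfc : ContinuousOn (fun s => G.Aa s *ᵥ x s + G.Ba s *ᵥ G.feedback l Y x s) (Icc 0 T) :=
    (h.contA.matrix_mulVec_rect hxc).add (h.contB.matrix_mulVec_rect hwc)
  have hd' : ∀ t ∈ Icc 0 T, HasDerivWithinAt x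
      (G.Aa t *ᵥ x t + G.Ba t *ᵥ G.feedback l Y x t) (Icc 0 T) t := fun t ht => by
    convert! hd t ht using 1
    rw [feedback, Matrix.mulVec_neg, Matrix.mulVec_mulVec, Matrix.sub_mulVec, Matrix.mul_assoc,
      sub_eq_add_neg]
  refine ⟨hwc.memLp_Icc 2, hxc, hfc.intervalIntegrable_of_Icc hT, fun t ht => ?_⟩
  have hsub : Icc 0 t ⊆ Icc 0 T := Icc_subset_Icc_right ht.2
  rw [intervalIntegral.integral_eq_sub_of_hasDeriv_right_of_le ht.1 (hxc.mono hsub)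
    (fun s hs => ((hd' s (hsub (Ioo_subset_Icc_self hs))).Ici_of_Icc
      ⟨hs.1.le, hs.2.trans_le ht.2⟩).mono Ioi_subset_Ici_self)
    ((hfc.mono hsub).intervalIntegrable_of_Icc ht.1), hx0, add_sub_cancel]

/-- Under the hypotheses of regularity the optimal value is attained by the feedback. -/
theorem IsRegular.lqValue_eq (h : G.IsRegular T l) (hT : 0 ≤ T)
    {Y : ℝ → Matrix (Fin nx ⊕ Unit) (Fin nx ⊕ Unit) ℝ} (hY : G.IsRDESolution T l Y) :
    G.lqValue T l = ((xInit nx ⬝ᵥ Y 0 *ᵥ xInit nx : ℝ) : EReal) := by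
  refine le_antisymm (iSup_le fun x => iSup₂_le fun w hxw =>
    EReal.coe_le_coe_iff.2 (h.lqCost_le hT hY hxw)) ?_
  obtain ⟨x, hx⟩ := h.exists_isClosedLoop hT hY
  have hadm := h.isAdmissible_feedback hT hY hx
  rw [← h.lqCost_feedback hT hY hadm]
  exact le_iSup_of_le x (le_iSup₂_of_le (G.feedback l Y x) hadm le_rfl)

/-- The linear-quadratic cost is affine in the multiplier. -/
theorem IsAdmissible.lqCost_eq_add (hT : 0 ≤ T) {x : ℝ → Fin nx ⊕ Unit → ℝ}
    {w : ℝ → Fin nw → ℝ} (h : G.IsAdmissible T x w)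
    (hW : ∀ α, ContinuousOn (fun t => G.W t α) (Icc 0 T)) (α : Fin m → ℝ) :
    G.lqCost T α x w = G.lqCost T l x w + ∑ i, G.subgrad T x w i * (α i - l i) := by
  have hWi := fun i => h.intervalIntegrable_quadForm hT (G.continuousOn_Wi hW i)
  have hsum : IntervalIntegrable (fun t => ∑ i, (Sum.elim (x t) (w t) ⬝ᵥ
      G.Wi i t *ᵥ Sum.elim (x t) (w t)) * (α i - l i)) volume 0 T := by
    simpa only [Finset.sum_fn] using
      IntervalIntegrable.sum Finset.univ fun i _ => (hWi i).mul_const (α i - l i)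
  simp only [lqCost, quadCost, subgrad, ← intervalIntegral.integral_mul_const]
  rw [← intervalIntegral.integral_finsetSum fun i _ => (hWi i).mul_const _,
    ← intervalIntegral.integral_add (h.intervalIntegrable_quadForm hT (hW l)) hsum]
  refine intervalIntegral.integral_congr fun t _ => ?_
  simp only [G.W_eq_W_add_sum t α l, Matrix.add_mulVec, Matrix.sum_mulVec, Matrix.smul_mulVec,
    dotProduct_add, dotProduct_sum, dotProduct_smul, smul_eq_mul, mul_comm]

theorem exists_isFeasible_of_mem_domain (hl : l ∈ G.domain T) : ∃ P, G.IsFeasible T l P := by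
  by_contra! hcon
  refine (lt_irrefl (⊤ : EReal)) (lt_of_le_of_lt ?_ hl)
  exact le_iInf₂ fun P hP => absurd hP (hcon P)

end UncertainLTV
end

/-! ### Duality, optimal feedback and the subgradient inequality -/

theorem theorem3 {nx nw nv ne m : ℕ} (G : UncertainLTV nx nw nv ne m) (T : ℝ) (hT : 0 < T)
    (hM : ∀ i, (G.M i).IsSymm)
    (hA : ContinuousOn G.Aa (Set.Icc 0 T)) (hB : ContinuousOn G.Ba (Set.Icc 0 T))
    (hQ : ∀ α, ContinuousOn (fun t => G.Q t α) (Set.Icc 0 T))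
    (hS : ∀ α, ContinuousOn (fun t => G.S t α) (Set.Icc 0 T))
    (hR : ∀ α, ContinuousOn (fun t => G.R t α) (Set.Icc 0 T))
    (l : Fin m → ℝ) (hl : l ∈ G.domain T) :
    G.lqValue T l = G.J T l ∧
    ∃ Y : ℝ → Matrix (Fin nx ⊕ Unit) (Fin nx ⊕ Unit) ℝ,
      G.IsRDESolution T l Y ∧
      (∀ Y', G.IsRDESolution T l Y' → Set.EqOn Y' Y (Set.Icc 0 T)) ∧
      ∃ x : ℝ → Fin nx ⊕ Unit → ℝ,
        G.IsClosedLoop T l Y x ∧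
        (∀ x', G.IsClosedLoop T l Y x' → Set.EqOn x' x (Set.Icc 0 T)) ∧
        G.IsAdmissible T x (G.feedback l Y x) ∧
        ((G.lqCost T l x (G.feedback l Y x) : ℝ) : EReal) = G.lqValue T l ∧
        ∀ α : Fin m → ℝ,
          G.J T α ≥ G.J T l +
            ((∑ i, G.subgrad T x (G.feedback l Y x) i * (α i - l i) : ℝ) : EReal) := by
  have hW : ∀ α, ContinuousOn (fun t => G.W t α) (Set.Icc 0 T) := fun α =>
    G.continuousOn_W hM (hQ α) (hS α) (hR α)
  -- Needed for every `α` in the domain, not just `l`: the subgradient inequality uses that `J`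
  -- equals the optimal value at both.
  have hreg : ∀ α ∈ G.domain T, G.IsRegular T α ∧ ∃ Y, G.IsRDESolution T α Y := fun α hα => by
    obtain ⟨P, hP⟩ := UncertainLTV.exists_isFeasible_of_mem_domain hα
    have h : G.IsRegular T α :=
      ⟨hM, hA, hB, hQ α, hS α, hR α, fun _ ht => G.posDef_neg_R hP ht⟩
    exact ⟨h, h.exists_isRDESolution hT.le hP⟩
  have hval : ∀ α ∈ G.domain T, G.lqValue T α = G.J T α := fun α hα => by
    obtain ⟨h, Y, hY⟩ := hreg α hα
    rw [h.lqValue_eq hT.le hY, h.J_eq hT hY]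
  obtain ⟨h, Y, hY⟩ := hreg l hl
  obtain ⟨x, hx⟩ := h.exists_isClosedLoop hT.le hY
  have hadm := h.isAdmissible_feedback hT.le hY hx
  have hopt : ((G.lqCost T l x (G.feedback l Y x) : ℝ) : EReal) = G.lqValue T l := by
    rw [h.lqCost_feedback hT.le hY hadm, h.lqValue_eq hT.le hY]
  refine ⟨hval l hl, Y, hY, fun Y' hY' => h.rdeSolution_unique hY hY', x, hx,
    fun x' hx' => h.isClosedLoop_unique hY hx hx', hadm, hopt, fun α => ?_⟩
  by_cases hα : α ∈ G.domain T
  -- The pair optimal for `l` is a competitor in the problem for `α`; by affinity its cost there is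
  -- the right-hand side.
  · rw [← hval l hl, ← hopt, ← hval α hα, ← EReal.coe_add,
      ← hadm.lqCost_eq_add hT.le hW α]
    exact le_iSup_of_le x (le_iSup₂_of_le (G.feedback l Y x) hadm le_rfl)
  · have htop : G.J T α = ⊤ := not_lt_top_iff.1 hα
    rw [htop]
    exact le_top
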